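/- Let $k$ be an algebraically closed field with $\operatorname{char} k\neq 2$, and let $D(\Lambda_2)$ (the Drinfel'd double of the Taft algebra for $n=2$) be the $k$-algebra generated by $x,X,g,G$ subject to $$x^2=X^2=0,\quad g^2=G^2=1,\quad gG=Gg,\quad gx=-xg,\quad gX=-Xg,\quad Gx=-xG,\quad GX=-XG,\quad xX+Xx=1-gG .$$ For $\alpha,\beta\in k$ let $H_{\alpha\beta}$ be the subalgebra generated by $g$, $G$ and $\alpha x+\beta X$. All modules are finite-dimensional left modules. For a $D(\Lambda_2)$-module $M$ define its rank variety by $$V^r(M)=\{0\}\cup\{(\alpha,\beta)\in k^2 : M|_{H_{\alpha\beta}}\text{ is not projective}\}\subseteq k^2 .$$ Let $\Omega(M)$ denote the kernel of a projective cover of $M$, let $\Omega^{-1}(M)$ denote the cokernel of an injective hull of $M$, and let $\Omega^{n}(M)$, $n\in\mathbb Z$, denote their iterates, with $\Omega^0(M)=M$ (these modules exist, and are determined up to isomorphism). Then the family $\{H_{\alpha\beta} : (\alpha,\beta)\neq(0,0)\}$ detects projectivity: a $D(\Lambda_2)$-module $M$ is projective if and only if $M|_{H_{\alpha\beta}}$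 is projective for all $(\alpha,\beta)\neq(0,0)$. Moreover, $V^r$ satisfies the following conditions. (C1) $V^r(M\oplus N)=V^r(M)\cup V^r(N)$ for all $D(\Lambda_2)$-modules $M,N$. (C2) If $0\to M_1\to M_2\to M_3\to 0$ is an exact sequence of $D(\Lambda_2)$-modules, then $V^r(M_i)\subseteq V^r(M_j)\cup V^r(M_s)$ whenever $\{i,j,s\}=\{1,2,3\}$. (C3) $V^r(\Omega^n(M))=V^r(M)$ for all $n\in\mathbb Z$ and all $D(\Lambda_2)$-modules $M$. (C4) (Dade's Lemma) $V^r(M)=\{0\}$ if and only if $M$ is projective. -/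

import Mathlib

universe u

/-! ### Finite-dimensional modules over a `k`-algebra -/

/-- A finite-dimensional left module over the `k`-algebra `A`: an object of `A`-mod. -/
structure FDMod (k A : Type u) [Field k] [Ring A] [Algebra k A] : Type (u + 1) where
  carrier : Type u
  [addCommGroup : AddCommGroup carrier]
  [moduleBase : Module k carrier]
  [module : Module A carrier]
  [isScalarTower : IsScalarTower k A carrier]
  [finiteDimensional : FiniteDimensional k carrier]

namespace FDMod

variable {k A : Type u} [Field k] [Ring A] [Algebra k A]

instance : CoeSort (FDMod k A) (Type u) := ⟨FDMod.carrier⟩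

attribute [instance] FDMod.addCommGroup FDMod.moduleBase FDMod.module
  FDMod.isScalarTower FDMod.finiteDimensional

/-- The direct sum `M ⊕ N`. -/
def directSum (M N : FDMod k A) : FDMod k A where
  carrier := M × N

/-- `π : P → M` is a projective cover: `P` is projective, `π` is surjective and its kernel is a
superfluous submodule of `P`. -/
def IsProjectiveCover {P M : FDMod k A} (π : P →ₗ[A] M) : Prop :=
  Module.Projective A P ∧ Function.Surjective π ∧
    ∀ U : Submodule A P, U ⊔ LinearMap.ker π = ⊤ → U = ⊤

/-- `ι : M → I` is an injective hull: `I` is injective, `ι` is injective and its image is an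
essential submodule of `I`. -/
def IsInjectiveHull {M I : FDMod k A} (ι : M →ₗ[A] I) : Prop :=
  Module.Injective A I ∧ Function.Injective ι ∧
    ∀ U : Submodule A I, U ⊓ LinearMap.range ι = ⊥ → U = ⊥

/-- `N ≅ Ω(M)`: `N` is isomorphic to the kernel of a projective cover of `M`, that is, there is an
exact sequence `0 → N → P → M → 0` in which `P → M` is a projective cover. -/
def IsOmega (M N : FDMod k A) : Prop :=
  ∃ (P : FDMod k A) (i : N →ₗ[A] P) (π : P →ₗ[A] M),
    IsProjectiveCover π ∧ Function.Injective i ∧ Function.Exact i π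

/-- `N ≅ Ω⁻¹(M)`: `N` is isomorphic to the cokernel of an injective hull of `M`, that is, there is
an exact sequence `0 → M → I → N → 0` in which `M → I` is an injective hull. -/
def IsOmegaInv (M N : FDMod k A) : Prop :=
  ∃ (I : FDMod k A) (ι : M →ₗ[A] I) (p : I →ₗ[A] N),
    IsInjectiveHull ι ∧ Function.Surjective p ∧ Function.Exact ι p

/-- The `n`-fold iterate of a binary relation `R` on modules, starting from isomorphism. -/
def IterateRel (R : FDMod k A → FDMod k A → Prop) : ℕ → FDMod k A → FDMod k A → Prop
  | 0, M, N => Nonempty (M ≃ₗ[A] N)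
  | n + 1, M, N => ∃ L : FDMod k A, IterateRel R n M L ∧ R L N

/-- `N ≅ Ωⁿ(M)`, for an integer `n`. -/
def IsOmegaPow : ℤ → FDMod k A → FDMod k A → Prop
  | Int.ofNat n => IterateRel IsOmega n
  | Int.negSucc n => IterateRel IsOmegaInv (n + 1)

end FDMod

/-! ### Detecting projectivity, and the conditions (C1)-(C4) -/

section Conditions

variable {k A : Type u} [Field k] [Ring A] [Algebra k A]

/-- A collection of subalgebras of `A` detects projectivity if a (finite-dimensional) `A`-module is
projective if and only if its restriction to every member of the collection is projective. -/
def DetectsProjectivity (𝒜 : Set (Subalgebra k A)) : Prop :=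
  ∀ M : FDMod k A, Module.Projective A M ↔ ∀ B ∈ 𝒜, Module.Projective B M

variable {S : Type u}

/-- (C1): `V(M ⊕ N) = V(M) ∪ V(N)`. -/
def CondC1 (V : FDMod k A → Set S) : Prop :=
  ∀ M N : FDMod k A, V (M.directSum N) = V M ∪ V N

/-- (C2): for every short exact sequence `0 → M₁ → M₂ → M₃ → 0`, each `V(Mᵢ)` is contained in the
union of the other two. -/
def CondC2 (V : FDMod k A → Set S) : Prop :=
  ∀ (M₁ M₂ M₃ : FDMod k A) (f : M₁ →ₗ[A] M₂) (h : M₂ →ₗ[A] M₃),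
    Function.Injective f → Function.Exact f h → Function.Surjective h →
      V M₁ ⊆ V M₂ ∪ V M₃ ∧ V M₂ ⊆ V M₁ ∪ V M₃ ∧ V M₃ ⊆ V M₁ ∪ V M₂

/-- (C3): for every integer `n` and every `M`, the module `Ωⁿ(M)` exists and
`V(Ωⁿ(M)) = V(M)`. -/
def CondC3 (V : FDMod k A → Set S) : Prop :=
  ∀ (n : ℤ) (M : FDMod k A),
    (∃ N : FDMod k A, FDMod.IsOmegaPow n M N) ∧
      ∀ N : FDMod k A, FDMod.IsOmegaPow n M N → V N = V M

/-- (C4), Dade's Lemma: `V(M) = {0}` if and only if `M` is projective. -/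
def CondC4 [Zero S] (V : FDMod k A → Set S) : Prop :=
  ∀ M : FDMod k A, V M = {0} ↔ Module.Projective A M

end Conditions

/-! ### The Drinfel'd double of the Taft algebra for `n = 2` -/

namespace DTaft

/-- The four generators. -/
inductive Gen : Type
  | x | X | g | G

/-- A generator as an element of the free algebra. -/
abbrev fr (k : Type u) [Field k] (a : Gen) : FreeAlgebra k Gen := FreeAlgebra.ι k a

/-- The defining relations of `D(Λ₂)`. -/
inductive Rel (k : Type u) [Field k] : FreeAlgebra k Gen → FreeAlgebra k Gen → Prop
  | x_sq : Rel k (fr k .x ^ 2) 0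
  | X_sq : Rel k (fr k .X ^ 2) 0
  | g_sq : Rel k (fr k .g ^ 2) 1
  | G_sq : Rel k (fr k .G ^ 2) 1
  | g_G : Rel k (fr k .g * fr k .G) (fr k .G * fr k .g)
  | g_x : Rel k (fr k .g * fr k .x) (-(fr k .x * fr k .g))
  | g_X : Rel k (fr k .g * fr k .X) (-(fr k .X * fr k .g))
  | G_x : Rel k (fr k .G * fr k .x) (-(fr k .x * fr k .G))
  | G_X : Rel k (fr k .G * fr k .X) (-(fr k .X * fr k .G))
  | x_X : Rel k (fr k .x * fr k .X + fr k .X * fr k .x) (1 - fr k .g * fr k .G)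

/-- The algebra `D(Λ₂)` over `k`, by generators and relations. -/
abbrev D (k : Type u) [Field k] : Type u := RingQuot (Rel k)

/-- A generator as an element of `D(Λ₂)`. -/
noncomputable def gen (k : Type u) [Field k] (a : Gen) : D k :=
  RingQuot.mkAlgHom k (Rel k) (FreeAlgebra.ι k a)

/-- The subalgebra `H_{αβ}` of `D(Λ₂)` generated by `g`, `G` and `αx + βX`. -/
noncomputable def H (k : Type u) [Field k] (α β : k) : Subalgebra k (D k) :=
  Algebra.adjoin k {gen k .g, gen k .G, α • gen k .x + β • gen k .X}

/-- The rank variety `Vʳ(M) = {0} ∪ {(α, β) ∈ k² : M restricted to H_{αβ} is not projective}`. -/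
def rankVariety (k : Type u) [Field k] (M : FDMod k (D k)) : Set (k × k) :=
  {0} ∪ {p : k × k | ¬ Module.Projective (H k p.1 p.2) M}

end DTaft

/-! Call an operator even or odd according to whether it commutes or anticommutes with `g` and `G`;
since 2 is invertible, averaging over these two involutions produces either parity. All commutators
below are graded.

Projectivity is encoded by operator identities of Higman type. Over `H_{αβ}`, with `y = αx + βX`, a
module is projective exactly when some `k`-linear `h` satisfies `yh + hy = 1`, for `(α, β) ≠ 0`.
Over `D(Λ₂)` it is projective exactly when some even `t` satisfies `[x, [X, t]] = 1`
(`HasUnitTrace`). Such a `t` turns `k`-linear sections and extensions into `D(Λ₂)`-linear ones. It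
also passes to retracts, and `M` tensored with the projective cover of the trivial module
(`Envelope`) has one; since `M` is both a quotient and a submodule of the envelope, projective
modules and injective modules have one too. If `αδ - βγ = 1`, then `[γx + δX, t]` is a homotopy for
`y`, so projectivity restricts.

The converse, Dade's lemma, is `hasUnitTrace_of_homotopies`. The central element `gG` splits `M`.
Where `gG = -1`, `xX + Xx = 2` and `xX/4` has trace one. Where `gG = 1`, `x` and `X` anticommute,
and an eigenvector argument over the algebraically closed field shows that the kernel of `xX` lies
in `xM + XM`; this makes the trace of a suitable `t` invertible.

(C1) and (C2) come from splitting exact sequences over each `H_{αβ}`, and (C3) from (C2) and the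
triviality of the variety of a projective or injective module. -/

section LinearOverGenerators

/-! ### Linearity from generators, and signed averaging over involutions -/

variable {k R M N : Type*} [Field k] [Ring R] [Algebra k R]
  [AddCommGroup M] [Module k M] [Module R M] [IsScalarTower k R M]
  [AddCommGroup N] [Module k N] [Module R N] [IsScalarTower k R N]

/-- A `k`-linear map that commutes with algebra generators is linear over the algebra. -/
theorem LinearMap.map_smul_of_adjoin_eq_top {s : Set R} (hs : Algebra.adjoin k s = ⊤)
    (f : M →ₗ[k] N) (hf : ∀ a ∈ s, ∀ m, f (a • m) = a • f m) (a : R) (m : M) :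
    f (a • m) = a • f m := by
  have ha : a ∈ Algebra.adjoin k s := hs ▸ Algebra.mem_top
  induction ha using Algebra.adjoin_induction generalizing m with
  | mem a h => exact hf a h m
  | algebraMap c => simp [algebraMap_smul]
  | add a b _ _ iha ihb => simp [add_smul, iha, ihb]
  | mul a b _ _ iha ihb => simp [mul_smul, iha, ihb]

/-- The linear map over an algebra given by a `k`-linear map commuting with generators. -/
def LinearMap.ofAdjoin {s : Set R} (hs : Algebra.adjoin k s = ⊤)
    (f : M →ₗ[k] N) (hf : ∀ a ∈ s, ∀ m, f (a • m) = a • f m) : M →ₗ[R] N where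
  toFun := f
  map_add' := f.map_add
  map_smul' a m := f.map_smul_of_adjoin_eq_top hs hf a m

/-- The average of `u` and its conjugate by an involution `a`, with sign `ε`. -/
def twistedAverage (ε : k) (a : R) (u : M →ₗ[k] N) : M →ₗ[k] N :=
  (2⁻¹ : k) • (u + ε • (Algebra.lsmul k k N a ∘ₗ u ∘ₗ Algebra.lsmul k k M a))

theorem twistedAverage_apply (ε : k) (a : R) (u : M →ₗ[k] N) (m : M) :
    twistedAverage ε a u m = (2⁻¹ : k) • (u m + ε • a • u (a • m)) := rfl

theorem twistedAverage_smul_self {ε : k} (hε : ε * ε = 1) {a : R} (ha : a * a = 1)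
    (u : M →ₗ[k] N) (m : M) :
    twistedAverage ε a u (a • m) = ε • a • twistedAverage ε a u m := by
  have h1 : ∀ n : N, a • a • n = n := fun n => by rw [smul_smul, ha, one_smul]
  have h2 : a • a • m = m := by rw [smul_smul, ha, one_smul]
  have h3 : ∀ n : N, ε • ε • n = n := fun n => by rw [smul_smul, hε, one_smul]
  simp only [twistedAverage_apply, smul_add, smul_comm a (2⁻¹ : k), smul_comm a ε, h1, h2, h3,
    smul_comm ε (2⁻¹ : k)]
  abel

theorem twistedAverage_smul_of_commute {ε η : k} {a b : R} (hab : a * b = b * a)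
    (u : M →ₗ[k] N) (hu : ∀ m, u (b • m) = η • b • u m) (m : M) :
    twistedAverage ε a u (b • m) = η • b • twistedAverage ε a u m := by
  have h1 : ∀ n : N, a • b • n = b • a • n := fun n => by rw [smul_smul, hab, mul_smul]
  have h2 : a • b • m = b • a • m := by rw [smul_smul, hab, mul_smul]
  simp only [twistedAverage_apply, h2, hu, smul_add, smul_comm a η, smul_comm b (2⁻¹ : k),
    smul_comm b ε, h1, smul_comm η (2⁻¹ : k), smul_comm η ε]

/-- Averaging over two commuting involutions makes a linear map equivariant up to sign. -/
def twistedAverage₂ (ε : k) (a b : R) (u : M →ₗ[k] N) : M →ₗ[k] N :=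
  twistedAverage ε a (twistedAverage ε b u)

theorem twistedAverage₂_smul_left {ε : k} (hε : ε * ε = 1) {a : R} (b : R) (ha : a * a = 1)
    (u : M →ₗ[k] N) (m : M) :
    twistedAverage₂ ε a b u (a • m) = ε • a • twistedAverage₂ ε a b u m :=
  twistedAverage_smul_self hε ha _ m

theorem twistedAverage₂_smul_right {ε : k} (hε : ε * ε = 1) {a b : R} (hb : b * b = 1)
    (hab : a * b = b * a) (u : M →ₗ[k] N) (m : M) :
    twistedAverage₂ ε a b u (b • m) = ε • b • twistedAverage₂ ε a b u m :=
  twistedAverage_smul_of_commute hab _ (twistedAverage_smul_self hε hb u) m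

section Sections

variable (h2 : (2 : k) ≠ 0)
include h2

theorem inv_two_smul_add_self (m : M) : (2⁻¹ : k) • (m + m) = m := by
  rw [← two_smul k m, smul_smul, inv_mul_cancel₀ h2, one_smul]

theorem twistedAverage_section {a : R} (ha : a * a = 1) (q : N →ₗ[R] M) (s : M →ₗ[k] N)
    (hs : ∀ m, q (s m) = m) (m : M) : q (twistedAverage (1 : k) a s m) = m := by
  have hq : ∀ (c : k) n, q (c • n) = c • q n := fun c n => q.map_smul_of_tower c n
  rw [twistedAverage_apply, hq, map_add, hq, map_smul, hs, hs, smul_smul, ha, one_smul, one_smul,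
    inv_two_smul_add_self h2]

theorem twistedAverage_extension {L : Type*} [AddCommGroup L]
    [Module R L] {a : R} (ha : a * a = 1) (f : L →ₗ[R] M)
    (w : L →ₗ[R] N) (r : M →ₗ[k] N) (hr : ∀ l, r (f l) = w l) (l : L) :
    twistedAverage (1 : k) a r (f l) = w l := by
  rw [twistedAverage_apply, ← map_smul f, hr, hr, map_smul w, smul_smul, ha, one_smul, one_smul,
    inv_two_smul_add_self h2]

/-- Because `a` anticommutes with `y`, the conjugate `-aha` is again a homotopy for `y`; the twisted
average is the midpoint of the two. -/
theorem twistedAverage_homotopy {a y : R} (ha : a * a = 1) (hay : a * y = -(y * a))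
    (h : M →ₗ[k] M) (hh : ∀ m, y • h m + h (y • m) = m) (m : M) :
    y • twistedAverage (-1 : k) a h m + twistedAverage (-1 : k) a h (y • m) = m := by
  have e1 : ∀ n : M, a • y • n = -(y • a • n) := fun n => by
    rw [smul_smul, hay, neg_smul, mul_smul]
  have e2 : y • a • h (a • m) = -(a • y • h (a • m)) := by rw [e1, neg_neg]
  have e3 : a • a • m = m := by rw [smul_smul, ha, one_smul]
  have e4 := congrArg (a • ·) (hh (a • m))
  simp only [smul_add, e3] at e4
  simp only [twistedAverage_apply]
  rw [smul_comm y, ← smul_add, e1 m, map_neg]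
  conv_rhs => rw [← inv_two_smul_add_self h2 m]
  congr 1
  refine Eq.trans ?_ (congrArg₂ (· + ·) (hh m) e4)
  simp only [smul_add, neg_smul, one_smul, smul_neg, e2, neg_neg]
  abel

end Sections

end LinearOverGenerators

/-! ### Contracting homotopies and splitting over a signed presentation -/

/-- Elements `g`, `G`, `y` generate `R`, where `g`, `G` are commuting involutions that anticommute
with `y`, and `y² = r (1 - gG)`. -/
structure IsSignedPresentation (k : Type*) {R : Type*} [Field k] [Ring R] [Algebra k R]
    (g G y : R) (r : k) : Prop where
  g_sq : g * g = 1
  G_sq : G * G = 1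
  g_G : g * G = G * g
  g_y : g * y = -(y * g)
  G_y : G * y = -(y * G)
  y_sq : y * y = r • (1 - g * G)
  adjoin_eq_top : Algebra.adjoin k {g, G, y} = ⊤

namespace IsSignedPresentation

variable {k R M N : Type*} [Field k] [Ring R] [Algebra k R]
  [AddCommGroup M] [Module k M] [Module R M] [IsScalarTower k R M]
  [AddCommGroup N] [Module k N] [Module R N] [IsScalarTower k R N]
  {g G y : R} {r : k}

section Relative

variable (P : IsSignedPresentation k g G y r)
include P

theorem y_y_smul (m : M) : y • y • m = r • (m - g • G • m) := by
  rw [smul_smul, P.y_sq, smul_assoc, sub_smul, one_smul, mul_smul]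

omit [Module k M] [IsScalarTower k R M] in
theorem g_y_smul (m : M) : g • y • m = -(y • g • m) := by
  rw [smul_smul, P.g_y, neg_smul, mul_smul]

omit [Module k M] [IsScalarTower k R M] in
theorem G_y_smul (m : M) : G • y • m = -(y • G • m) := by
  rw [smul_smul, P.G_y, neg_smul, mul_smul]

/-- If `u` anticommutes with `g` and `G`, then `y u + u y` is linear. -/
def relativeTrace (u : M →ₗ[k] N) (hg : ∀ m, u (g • m) = -(g • u m))
    (hG : ∀ m, u (G • m) = -(G • u m)) : M →ₗ[R] N :=
  LinearMap.ofAdjoin P.adjoin_eq_top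
    (Algebra.lsmul k k N y ∘ₗ u + u ∘ₗ Algebra.lsmul k k M y) <| by
  rintro a (rfl | rfl | rfl) m <;>
  simp only [LinearMap.add_apply, LinearMap.comp_apply, Algebra.lsmul_coe, smul_add]
  · rw [hg, P.g_y_smul, smul_neg, ← neg_eq_iff_eq_neg.mpr (P.g_y_smul m), map_neg, hg, neg_neg]
  · rw [hG, P.G_y_smul, smul_neg, ← neg_eq_iff_eq_neg.mpr (P.G_y_smul m), map_neg, hG, neg_neg]
  -- Commuting with `y` amounts to `y²u = uy²`, which holds because `u` anticommutes with both `g`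
  -- and `G`, hence commutes with `gG`.
  · rw [P.y_y_smul, P.y_y_smul, map_smul u r, map_sub, hg, hG, smul_neg, neg_neg, add_comm]

theorem relativeTrace_apply (u : M →ₗ[k] N) (hg : ∀ m, u (g • m) = -(g • u m))
    (hG : ∀ m, u (G • m) = -(G • u m)) (m : M) :
    P.relativeTrace u hg hG m = y • u m + u (y • m) := rfl

variable (h2 : (2 : k) ≠ 0) {h : M →ₗ[k] M} (hh : ∀ m, y • h m + h (y • m) = m)
include h2 hh

theorem exists_anticommuting_homotopy :
    ∃ h' : M →ₗ[k] M, (∀ m, y • h' m + h' (y • m) = m) ∧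
      (∀ m, h' (g • m) = -(g • h' m)) ∧ ∀ m, h' (G • m) = -(G • h' m) := by
  refine ⟨twistedAverage₂ (-1 : k) g G h, ?_, fun m => ?_, fun m => ?_⟩
  · exact twistedAverage_homotopy h2 P.g_sq P.g_y _
      (twistedAverage_homotopy h2 P.G_sq P.G_y h hh)
  · rw [twistedAverage₂_smul_left (by norm_num) G P.g_sq, neg_one_smul]
  · rw [twistedAverage₂_smul_right (by norm_num) P.G_sq P.g_G, neg_one_smul]

/-- If `s` is a section commuting with `g` and `G`, then `sh` is odd and `y(sh) + (sh)y` is linear.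
Applying `q` turns it into `yh + hy = 1`. -/
theorem exists_section (q : N →ₗ[R] M) (hq : Function.Surjective q) :
    ∃ s : M →ₗ[R] N, ∀ m, q (s m) = m := by
  obtain ⟨h, hh, hg, hG⟩ := P.exists_anticommuting_homotopy h2 hh
  obtain ⟨s₀, hs₀⟩ := LinearMap.exists_rightInverse_of_surjective (q.restrictScalars k)
    (LinearMap.range_eq_top.mpr hq)
  let s := twistedAverage₂ (1 : k) g G s₀
  have hs : ∀ m, q (s m) = m := twistedAverage_section h2 P.g_sq q _
    (twistedAverage_section h2 P.G_sq q _ (LinearMap.congr_fun hs₀))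
  have hsg : ∀ m, s (g • m) = g • s m := fun m =>
    (twistedAverage₂_smul_left (by norm_num) G P.g_sq s₀ m).trans (one_smul _ _)
  have hsG : ∀ m, s (G • m) = G • s m := fun m =>
    (twistedAverage₂_smul_right (by norm_num) P.G_sq P.g_G s₀ m).trans (one_smul _ _)
  refine ⟨P.relativeTrace (s ∘ₗ h) (fun m => ?_) (fun m => ?_), fun m => ?_⟩
  · simp only [LinearMap.comp_apply, hg, map_neg, hsg]
  · simp only [LinearMap.comp_apply, hG, map_neg, hsG]
  · rw [relativeTrace_apply, map_add, map_smul q]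
    simp only [LinearMap.comp_apply, hs, hh]

/-- Dual to `exists_section`, with the homotopy composed on the other side. It is the injectivity
needed for quotients in (C2). -/
theorem exists_retraction (f : M →ₗ[R] N) (hf : Function.Injective f) :
    ∃ s : N →ₗ[R] M, ∀ m, s (f m) = m := by
  obtain ⟨h, hh, hg, hG⟩ := P.exists_anticommuting_homotopy h2 hh
  obtain ⟨s₀, hs₀⟩ := LinearMap.exists_leftInverse_of_injective (f.restrictScalars k)
    (LinearMap.ker_eq_bot.mpr hf)
  let s := twistedAverage₂ (1 : k) g G s₀
  have hs : ∀ m, s (f m) = m := twistedAverage_extension h2 P.g_sq f LinearMap.id _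
    (twistedAverage_extension h2 P.G_sq f LinearMap.id _ (LinearMap.congr_fun hs₀))
  have hsg : ∀ m, s (g • m) = g • s m := fun m =>
    (twistedAverage₂_smul_left (by norm_num) G P.g_sq s₀ m).trans (one_smul _ _)
  have hsG : ∀ m, s (G • m) = G • s m := fun m =>
    (twistedAverage₂_smul_right (by norm_num) P.G_sq P.g_G s₀ m).trans (one_smul _ _)
  refine ⟨P.relativeTrace (h ∘ₗ s) (fun m => ?_) (fun m => ?_), fun m => ?_⟩
  · simp only [LinearMap.comp_apply, hg, hsg]
  · simp only [LinearMap.comp_apply, hG, hsG]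
  · rw [relativeTrace_apply, ← map_smul f]
    simp only [LinearMap.comp_apply, hs, hh]

theorem projective_of_homotopy : Module.Projective R M := by
  obtain ⟨s, hs⟩ := P.exists_section h2 hh (Finsupp.linearCombination R (id : M → M))
    (fun x => ⟨Finsupp.single x 1, by simp⟩)
  exact ⟨s, hs⟩

end Relative

end IsSignedPresentation

/-! ### Relations in the double and the presentation of its subalgebras -/

namespace DTaft

section Relations

variable (k : Type u) [Field k]

theorem gen_x_mul_self : gen k .x * gen k .x = 0 := by
  simpa [gen, sq] using RingQuot.mkAlgHom_rel k (Rel.x_sq (k := k))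

theorem gen_X_mul_self : gen k .X * gen k .X = 0 := by
  simpa [gen, sq] using RingQuot.mkAlgHom_rel k (Rel.X_sq (k := k))

theorem gen_g_mul_self : gen k .g * gen k .g = 1 := by
  simpa [gen, sq] using RingQuot.mkAlgHom_rel k (Rel.g_sq (k := k))

theorem gen_G_mul_self : gen k .G * gen k .G = 1 := by
  simpa [gen, sq] using RingQuot.mkAlgHom_rel k (Rel.G_sq (k := k))

theorem gen_g_mul_G : gen k .g * gen k .G = gen k .G * gen k .g := by
  simpa [gen] using RingQuot.mkAlgHom_rel k (Rel.g_G (k := k))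

theorem gen_g_mul_x : gen k .g * gen k .x = -(gen k .x * gen k .g) := by
  simpa [gen] using RingQuot.mkAlgHom_rel k (Rel.g_x (k := k))

theorem gen_g_mul_X : gen k .g * gen k .X = -(gen k .X * gen k .g) := by
  simpa [gen] using RingQuot.mkAlgHom_rel k (Rel.g_X (k := k))

theorem gen_G_mul_x : gen k .G * gen k .x = -(gen k .x * gen k .G) := by
  simpa [gen] using RingQuot.mkAlgHom_rel k (Rel.G_x (k := k))

theorem gen_G_mul_X : gen k .G * gen k .X = -(gen k .X * gen k .G) := by
  simpa [gen] using RingQuot.mkAlgHom_rel k (Rel.G_X (k := k))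

theorem gen_x_mul_X : gen k .x * gen k .X + gen k .X * gen k .x = 1 - gen k .g * gen k .G := by
  simpa [gen] using RingQuot.mkAlgHom_rel k (Rel.x_X (k := k))

theorem adjoin_range_gen : Algebra.adjoin k (Set.range (gen k)) = ⊤ := by
  have h : Set.range (gen k) =
      RingQuot.mkAlgHom k (Rel k) '' Set.range (FreeAlgebra.ι k) := by
    rw [← Set.range_comp]; rfl
  rw [h, ← AlgHom.map_adjoin, FreeAlgebra.adjoin_range_ι, Algebra.map_top,
    AlgHom.range_eq_top]
  exact RingQuot.mkAlgHom_surjective k (Rel k)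

end Relations

section Actions

variable {k : Type u} [Field k] {M : Type*} [AddCommGroup M] [Module (D k) M] (m : M)

theorem x_x_smul : gen k .x • gen k .x • m = 0 := by
  rw [smul_smul, gen_x_mul_self, zero_smul]

theorem X_X_smul : gen k .X • gen k .X • m = 0 := by
  rw [smul_smul, gen_X_mul_self, zero_smul]

theorem g_g_smul : gen k .g • gen k .g • m = m := by
  rw [smul_smul, gen_g_mul_self, one_smul]

theorem G_G_smul : gen k .G • gen k .G • m = m := by
  rw [smul_smul, gen_G_mul_self, one_smul]

theorem G_g_smul : gen k .G • gen k .g • m = gen k .g • gen k .G • m := by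
  rw [smul_smul, ← gen_g_mul_G, mul_smul]

theorem g_x_smul : gen k .g • gen k .x • m = -(gen k .x • gen k .g • m) := by
  rw [smul_smul, gen_g_mul_x, neg_smul, mul_smul]

theorem g_X_smul : gen k .g • gen k .X • m = -(gen k .X • gen k .g • m) := by
  rw [smul_smul, gen_g_mul_X, neg_smul, mul_smul]

theorem G_x_smul : gen k .G • gen k .x • m = -(gen k .x • gen k .G • m) := by
  rw [smul_smul, gen_G_mul_x, neg_smul, mul_smul]

theorem G_X_smul : gen k .G • gen k .X • m = -(gen k .X • gen k .G • m) := by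
  rw [smul_smul, gen_G_mul_X, neg_smul, mul_smul]

theorem X_x_smul : gen k .X • gen k .x • m =
    m - gen k .g • gen k .G • m - gen k .x • gen k .X • m := by
  rw [eq_sub_iff_add_eq, add_comm, smul_smul, smul_smul, ← add_smul, gen_x_mul_X, sub_smul,
    one_smul, mul_smul]

end Actions

section Subalgebras

variable (k : Type u) [Field k] (α β : k)

/-- The generator `g` of `H_{αβ}`. -/
noncomputable def H.g : H k α β := ⟨gen k .g, Algebra.subset_adjoin (by simp)⟩

/-- The generator `G` of `H_{αβ}`. -/
noncomputable def H.G : H k α β := ⟨gen k .G, Algebra.subset_adjoin (by simp)⟩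

/-- The generator `αx + βX` of `H_{αβ}`. -/
noncomputable def H.y : H k α β :=
  ⟨α • gen k .x + β • gen k .X, Algebra.subset_adjoin (by simp)⟩

theorem H.isSignedPresentation :
    IsSignedPresentation k (H.g k α β) (H.G k α β) (H.y k α β) (α * β) where
  g_sq := Subtype.ext (gen_g_mul_self k)
  G_sq := Subtype.ext (gen_G_mul_self k)
  g_G := Subtype.ext (gen_g_mul_G k)
  g_y := Subtype.ext <| by
    change gen k .g * (α • gen k .x + β • gen k .X) = -((α • gen k .x + β • gen k .X) * gen k .g)
    simp only [mul_add, add_mul, mul_smul_comm, smul_mul_assoc, gen_g_mul_x, gen_g_mul_X,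
      smul_neg, neg_add]
  G_y := Subtype.ext <| by
    change gen k .G * (α • gen k .x + β • gen k .X) = -((α • gen k .x + β • gen k .X) * gen k .G)
    simp only [mul_add, add_mul, mul_smul_comm, smul_mul_assoc, gen_G_mul_x, gen_G_mul_X,
      smul_neg, neg_add]
  y_sq := Subtype.ext <| by
    change (α • gen k .x + β • gen k .X) * (α • gen k .x + β • gen k .X) =
      (α * β) • (1 - gen k .g * gen k .G)
    simp only [mul_add, add_mul, mul_smul_comm, smul_mul_assoc, gen_x_mul_self, gen_X_mul_self,
      ← gen_x_mul_X, smul_zero, smul_add, mul_smul, smul_comm β α]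
    abel
  adjoin_eq_top := by
    have h : ({H.g k α β, H.G k α β, H.y k α β} : Set (H k α β)) =
        ((↑) : H k α β → D k) ⁻¹' {gen k .g, gen k .G, α • gen k .x + β • gen k .X} := by
      ext a
      simp only [Set.mem_insert_iff, Set.mem_singleton_iff, Set.mem_preimage, Subtype.ext_iff]
      rfl
    rw [h]
    exact Algebra.adjoin_adjoin_coe_preimage

end Subalgebras

end DTaft

namespace DTaft

section Actions

variable {k : Type u} [Field k] {M : Type*} [AddCommGroup M] [Module (D k) M] (m : M)

theorem x_g_smul : gen k .x • gen k .g • m = -(gen k .g • gen k .x • m) := by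
  rw [g_x_smul, neg_neg]

theorem X_g_smul : gen k .X • gen k .g • m = -(gen k .g • gen k .X • m) := by
  rw [g_X_smul, neg_neg]

theorem x_G_smul : gen k .x • gen k .G • m = -(gen k .G • gen k .x • m) := by
  rw [G_x_smul, neg_neg]

theorem X_G_smul : gen k .X • gen k .G • m = -(gen k .G • gen k .X • m) := by
  rw [G_X_smul, neg_neg]

end Actions

/-! ### The trace `[x, [X, u]]` and the projectivity criterion -/

section Trace

variable {k : Type u} [Field k] {M N : Type*}
  [AddCommGroup M] [Module k M] [Module (D k) M] [IsScalarTower k (D k) M]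
  [AddCommGroup N] [Module k N] [Module (D k) N] [IsScalarTower k (D k) N]

/-- The iterated graded commutator `[x, [X, u]]`. -/
noncomputable def preTrace (u : M →ₗ[k] N) : M →ₗ[k] N :=
  Algebra.lsmul k k N (gen k .x) ∘ₗ Algebra.lsmul k k N (gen k .X) ∘ₗ u
    - Algebra.lsmul k k N (gen k .x) ∘ₗ u ∘ₗ Algebra.lsmul k k M (gen k .X)
    + Algebra.lsmul k k N (gen k .X) ∘ₗ u ∘ₗ Algebra.lsmul k k M (gen k .x)
    - u ∘ₗ Algebra.lsmul k k M (gen k .X) ∘ₗ Algebra.lsmul k k M (gen k .x)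

theorem preTrace_apply (u : M →ₗ[k] N) (m : M) :
    preTrace u m = gen k .x • gen k .X • u m - gen k .x • u (gen k .X • m)
      + gen k .X • u (gen k .x • m) - u (gen k .X • gen k .x • m) := rfl

/-- The `D(Λ₂)`-linear map `[x, [X, u]]` of a map `u` commuting with `g` and `G`. -/
noncomputable def trace (u : M →ₗ[k] N) (hg : ∀ m, u (gen k .g • m) = gen k .g • u m)
    (hG : ∀ m, u (gen k .G • m) = gen k .G • u m) : M →ₗ[D k] N :=
  LinearMap.ofAdjoin (adjoin_range_gen k) (preTrace u) <| by
  -- Commutation with `x` comes from `x² = 0`. For `X`, what remains after using `X² = 0` is the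
  -- commutator of `1 - gG` with `[X, u]`, which vanishes since `gG` commutes with `X` and with `u`.
  rintro _ ⟨a | _, rfl⟩ m <;> simp only [preTrace_apply]
  · simp only [X_x_smul, x_x_smul, smul_zero, map_zero, map_sub, hg, hG, smul_sub, smul_add]
    abel
  · simp only [X_x_smul, X_X_smul, smul_zero, map_zero, map_sub, hg, hG, smul_sub, smul_add]
    simp only [X_g_smul, X_G_smul, smul_neg, neg_neg]
    abel
  · simp only [x_g_smul, X_g_smul, map_neg, hg, smul_neg, smul_sub, smul_add, neg_neg]
  · simp only [x_G_smul, X_G_smul, map_neg, hG, smul_neg, smul_sub, smul_add, neg_neg]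

theorem trace_apply (u : M →ₗ[k] N) (hg : ∀ m, u (gen k .g • m) = gen k .g • u m)
    (hG : ∀ m, u (gen k .G • m) = gen k .G • u m) (m : M) :
    trace u hg hG m = preTrace u m := rfl

variable (k M) in
/-- There is an endomorphism commuting with `g` and `G` whose trace is the identity. -/
def HasUnitTrace : Prop :=
  ∃ t : M →ₗ[k] M, (∀ m, t (gen k .g • m) = gen k .g • t m) ∧
    (∀ m, t (gen k .G • m) = gen k .G • t m) ∧ ∀ m, preTrace t m = m

theorem HasUnitTrace.of_retract (ht : HasUnitTrace k M) (i : N →ₗ[D k] M) (p : M →ₗ[D k] N)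
    (hpi : ∀ n, p (i n) = n) : HasUnitTrace k N := by
  obtain ⟨t, hg, hG, ht⟩ := ht
  refine ⟨p.restrictScalars k ∘ₗ t ∘ₗ i.restrictScalars k, fun n => ?_, fun n => ?_, fun n => ?_⟩
  · simp [hg]
  · simp [hG]
  · have h := congrArg p (ht (i n))
    simpa only [preTrace_apply, map_add, map_sub, map_smul i, map_smul p, hpi,
      LinearMap.comp_apply, LinearMap.restrictScalars_apply] using h

/-- The operators `[x, ·]` and `[X, ·]` square to zero and anticommute on even maps, since `[x, X] =
1 - gG` commutes with these. Hence `[y, [z, t]]` is alternating in `y` and `z`: a change of basis of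
the span of `x` and `X` multiplies the trace by the determinant. -/
theorem HasUnitTrace.exists_homotopy (ht : HasUnitTrace k M) {α β : k} (h : (α, β) ≠ (0, 0)) :
    ∃ h : M →ₗ[k] M, ∀ m, (α • gen k .x + β • gen k .X) • h m +
      h ((α • gen k .x + β • gen k .X) • m) = m := by
  obtain ⟨t, hg, hG, ht⟩ := ht
  obtain ⟨γ, δ, hdet⟩ : ∃ γ δ : k, α * δ - β * γ = 1 := by
    by_cases hα : α = 0
    · have hβ : β ≠ 0 := fun hβ => h (by rw [hα, hβ])
      exact ⟨-β⁻¹, 0, by simp [hβ]⟩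
    · exact ⟨0, α⁻¹, by simp [hα]⟩
  refine ⟨Algebra.lsmul k k M (γ • gen k .x + δ • gen k .X) ∘ₗ t
    - t ∘ₗ Algebra.lsmul k k M (γ • gen k .x + δ • gen k .X), fun m => ?_⟩
  have e : (α * δ - β * γ) • preTrace t m = m := by rw [hdet, one_smul, ht]
  conv_rhs => rw [← e]
  have hx : ∀ (c : k) (n : M), gen k .x • c • n = c • gen k .x • n := fun c n => smul_comm _ _ _
  have hX : ∀ (c : k) (n : M), gen k .X • c • n = c • gen k .X • n := fun c n => smul_comm _ _ _
  simp only [preTrace_apply, LinearMap.sub_apply, LinearMap.comp_apply, Algebra.lsmul_coe]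
  simp only [add_smul, smul_assoc, smul_add, smul_sub, map_add, map_sub, map_smul t, hx, hX, x_x_smul,
    X_X_smul, X_x_smul, hg, hG, smul_zero, map_zero]
  have e : ∀ (a : D k) (n : M), a • n = Algebra.lsmul k k M a n := fun _ _ => rfl
  simp only [e]
  module

section

variable (h2 : (2 : k) ≠ 0)
include h2

/-- For an even section `s`, the map `[x, [X, st]]` is linear, and `q` sends it to `[x, [X, t]] =
1`. -/
theorem HasUnitTrace.exists_section (ht : HasUnitTrace k M) (q : N →ₗ[D k] M)
    (hq : Function.Surjective q) : ∃ s : M →ₗ[D k] N, ∀ m, q (s m) = m := by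
  obtain ⟨t, hg, hG, ht⟩ := ht
  obtain ⟨s₀, hs₀⟩ := LinearMap.exists_rightInverse_of_surjective (q.restrictScalars k)
    (LinearMap.range_eq_top.mpr hq)
  let s := twistedAverage₂ (1 : k) (gen k .g) (gen k .G) s₀
  have hs : ∀ m, q (s m) = m := twistedAverage_section h2 (gen_g_mul_self k) q _
    (twistedAverage_section h2 (gen_G_mul_self k) q _ (LinearMap.congr_fun hs₀))
  have hsg : ∀ m, s (gen k .g • m) = gen k .g • s m := fun m =>
    (twistedAverage₂_smul_left (by norm_num) _ (gen_g_mul_self k) s₀ m).trans (one_smul _ _)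
  have hsG : ∀ m, s (gen k .G • m) = gen k .G • s m := fun m =>
    (twistedAverage₂_smul_right (by norm_num) (gen_G_mul_self k) (gen_g_mul_G k) s₀ m).trans
      (one_smul _ _)
  refine ⟨trace (s ∘ₗ t) (fun m => ?_) (fun m => ?_), fun m => ?_⟩
  · simp only [LinearMap.comp_apply, hg, hsg]
  · simp only [LinearMap.comp_apply, hG, hsG]
  · simp only [trace_apply, preTrace_apply, LinearMap.comp_apply, map_add, map_sub, map_smul q, hs]
    exact ht m

theorem HasUnitTrace.projective (ht : HasUnitTrace k M) : Module.Projective (D k) M := by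
  obtain ⟨s, hs⟩ := ht.exists_section h2 (N := M →₀ D k)
    (Finsupp.linearCombination (D k) (id : M → M))
    (fun x => ⟨Finsupp.single x 1, by simp⟩)
  exact ⟨s, hs⟩

theorem HasUnitTrace.exists_extension (ht : HasUnitTrace k M) {L : Type*} [AddCommGroup L]
    [Module k L] [Module (D k) L] [IsScalarTower k (D k) L] (f : L →ₗ[D k] N)
    (hf : Function.Injective f) (w : L →ₗ[D k] M) : ∃ v : N →ₗ[D k] M, ∀ l, v (f l) = w l := by
  obtain ⟨t, hg, hG, ht⟩ := ht
  obtain ⟨r₀, hr₀⟩ := LinearMap.exists_leftInverse_of_injective (f.restrictScalars k)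
    (LinearMap.ker_eq_bot.mpr hf)
  let s₀ := w.restrictScalars k ∘ₗ r₀
  have hs₀ : ∀ l, s₀ (f l) = w l := fun l => congrArg w (LinearMap.congr_fun hr₀ l)
  let s := twistedAverage₂ (1 : k) (gen k .g) (gen k .G) s₀
  have hs : ∀ l, s (f l) = w l := twistedAverage_extension h2 (gen_g_mul_self k) f w _
    (twistedAverage_extension h2 (gen_G_mul_self k) f w _ hs₀)
  have hsg : ∀ m, s (gen k .g • m) = gen k .g • s m := fun m =>
    (twistedAverage₂_smul_left (by norm_num) _ (gen_g_mul_self k) s₀ m).trans (one_smul _ _)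
  have hsG : ∀ m, s (gen k .G • m) = gen k .G • s m := fun m =>
    (twistedAverage₂_smul_right (by norm_num) (gen_G_mul_self k) (gen_g_mul_G k) s₀ m).trans
      (one_smul _ _)
  refine ⟨trace (t ∘ₗ s) (fun m => ?_) (fun m => ?_), fun l => ?_⟩
  · simp only [LinearMap.comp_apply, hg, hsg]
  · simp only [LinearMap.comp_apply, hG, hsG]
  · simp only [trace_apply, preTrace_apply, LinearMap.comp_apply, ← map_smul f, hs, map_smul w]
    exact ht (w l)

end

end Trace

theorem HasUnitTrace.injective {k : Type u} [Field k] (h2 : (2 : k) ≠ 0) {M : Type u}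
    [AddCommGroup M] [Module k M] [Module (D k) M] [IsScalarTower k (D k) M]
    (ht : HasUnitTrace k M) : Module.Injective (D k) M where
  out X Y _ _ _ _ f hf w := by
    -- The test modules for injectivity are arbitrary `D k`-modules, so their `k`-structure is
    -- obtained from the algebra map.
    let : Module k X := Module.compHom X (algebraMap k (D k))
    let : Module k Y := Module.compHom Y (algebraMap k (D k))
    have : IsScalarTower k (D k) X := IsScalarTower.of_algebraMap_smul fun _ _ => rfl
    have : IsScalarTower k (D k) Y := IsScalarTower.of_algebraMap_smul fun _ _ => rfl
    exact ht.exists_extension h2 f hf w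

/-! ### A module with unit trace above and below a given module -/

section Envelope

variable (k : Type u) [Field k] (M : Type u) [AddCommGroup M] [Module k M] [Module (D k) M]
  [IsScalarTower k (D k) M]

/-- The operators by which the generators act on the tensor product of `M` with the projective
cover of the trivial module, written in a basis of the latter. -/
noncomputable def envelopeOp : Gen → Module.End k (M × M × M × M)
  | .x =>
    { toFun := fun m => (gen k .x • m.1, gen k .x • m.2.1 + gen k .g • m.1, gen k .x • m.2.2.1,
        gen k .x • m.2.2.2 + gen k .g • m.2.2.1)
      map_add' := fun m n => by ext <;> simp <;> abel
      map_smul' := fun c m => by ext <;> simp [smul_comm _ c] }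
  | .X =>
    { toFun := fun m => (gen k .X • m.1, gen k .X • m.2.1, gen k .X • m.2.2.1 + gen k .G • m.1,
        gen k .X • m.2.2.2 - gen k .G • m.2.1)
      map_add' := fun m n => by ext <;> simp <;> abel
      map_smul' := fun c m => by ext <;> simp [smul_comm _ c, smul_sub] }
  | .g =>
    { toFun := fun m => (gen k .g • m.1, -(gen k .g • m.2.1), -(gen k .g • m.2.2.1),
        gen k .g • m.2.2.2)
      map_add' := fun m n => by ext <;> simp <;> abel
      map_smul' := fun c m => by ext <;> simp [smul_comm _ c] }
  | .G =>
    { toFun := fun m => (gen k .G • m.1, -(gen k .G • m.2.1), -(gen k .G • m.2.2.1),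
        gen k .G • m.2.2.2)
      map_add' := fun m n => by ext <;> simp <;> abel
      map_smul' := fun c m => by ext <;> simp [smul_comm _ c] }

theorem envelopeOp_rel {a b : FreeAlgebra k Gen} (h : Rel k a b) :
    FreeAlgebra.lift k (envelopeOp k M) a = FreeAlgebra.lift k (envelopeOp k M) b := by
  cases h <;> refine LinearMap.ext fun m => ?_ <;>
  simp only [fr, sq, map_mul, map_add, map_sub, map_neg, map_zero, map_one,
    FreeAlgebra.lift_ι_apply, Module.End.mul_apply, LinearMap.add_apply, LinearMap.sub_apply,
    LinearMap.neg_apply, LinearMap.zero_apply, Module.End.one_apply, envelopeOp, LinearMap.coe_mk,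
    AddHom.coe_mk, smul_add, smul_sub, smul_neg, x_x_smul, X_X_smul, g_g_smul, G_G_smul, G_g_smul,
    X_x_smul, x_g_smul, x_G_smul, X_g_smul, X_G_smul, neg_neg] <;>
  ext <;> simp <;> abel

/-- The action of `D(Λ₂)` given by `envelopeOp`. -/
noncomputable def envelopeRep : D k →ₐ[k] Module.End k (M × M × M × M) :=
  RingQuot.liftAlgHom k ⟨FreeAlgebra.lift k (envelopeOp k M), fun _ _ => envelopeOp_rel k M⟩

theorem envelopeRep_gen (a : Gen) : envelopeRep k M (gen k a) = envelopeOp k M a := by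
  simp [envelopeRep, gen]

/-- A relatively free module with a surjection to `M` and an embedding of `M`. -/
def Envelope : Type u := M × M × M × M

namespace Envelope

instance : AddCommGroup (Envelope M) := inferInstanceAs (AddCommGroup (M × M × M × M))

instance : Module k (Envelope M) := inferInstanceAs (Module k (M × M × M × M))

instance [FiniteDimensional k M] : FiniteDimensional k (Envelope M) :=
  inferInstanceAs (FiniteDimensional k (M × M × M × M))

noncomputable instance : Module (D k) (Envelope M) :=
  Module.compHom (M × M × M × M) (envelopeRep k M).toRingHom

instance : IsScalarTower k (D k) (Envelope M) :=
  IsScalarTower.of_algebraMap_smul fun c m =>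
    LinearMap.congr_fun ((envelopeRep k M).commutes c) m

theorem gen_smul (a : Gen) (m : Envelope M) : gen k a • m = envelopeOp k M a m :=
  LinearMap.congr_fun (envelopeRep_gen k M a) m

variable {k M}

/-- The element of the envelope with the given coordinates. -/
def mk (a b c d : M) : Envelope M := (a, b, c, d)

omit [Module k M] [Module (D k) M] [IsScalarTower k (D k) M] in
theorem mk_add_mk (a b c d a' b' c' d' : M) :
    mk a b c d + mk a' b' c' d' = mk (a + a') (b + b') (c + c') (d + d') := rfl

omit [Module k M] [Module (D k) M] [IsScalarTower k (D k) M] in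
theorem mk_sub_mk (a b c d a' b' c' d' : M) :
    mk a b c d - mk a' b' c' d' = mk (a - a') (b - b') (c - c') (d - d') := rfl

theorem x_smul_mk (a b c d : M) : gen k .x • mk a b c d =
    mk (gen k .x • a) (gen k .x • b + gen k .g • a) (gen k .x • c)
      (gen k .x • d + gen k .g • c) := gen_smul k M .x _

theorem X_smul_mk (a b c d : M) : gen k .X • mk a b c d =
    mk (gen k .X • a) (gen k .X • b) (gen k .X • c + gen k .G • a)
      (gen k .X • d - gen k .G • b) := gen_smul k M .X _

theorem g_smul_mk (a b c d : M) : gen k .g • mk a b c d =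
    mk (gen k .g • a) (-(gen k .g • b)) (-(gen k .g • c)) (gen k .g • d) := gen_smul k M .g _

theorem G_smul_mk (a b c d : M) : gen k .G • mk a b c d =
    mk (gen k .G • a) (-(gen k .G • b)) (-(gen k .G • c)) (gen k .G • d) := gen_smul k M .G _

variable (k M)

/-- The projection of the envelope onto `M`. -/
noncomputable def proj : Envelope M →ₗ[D k] M :=
  LinearMap.ofAdjoin (k := k) (adjoin_range_gen k)
    { toFun := fun m : Envelope M => m.1
      map_add' := fun _ _ => rfl
      map_smul' := fun _ _ => rfl } <| by
    rintro _ ⟨_ | _, rfl⟩ m <;> rw [gen_smul] <;> rfl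

theorem proj_surjective : Function.Surjective (proj k M) := fun m => ⟨mk m 0 0 0, rfl⟩

/-- The embedding of `M` in the envelope. -/
noncomputable def incl : M →ₗ[D k] Envelope M :=
  LinearMap.ofAdjoin (k := k) (adjoin_range_gen k)
    { toFun := fun m : M => mk 0 0 0 m
      map_add' := fun _ _ => by simp [mk_add_mk]
      map_smul' := fun c m => by
        change mk 0 0 0 (c • m) = mk (c • 0) (c • 0) (c • 0) (c • m)
        simp } <| by
    rintro _ ⟨_ | _, rfl⟩ m <;>
    simp [x_smul_mk, X_smul_mk, g_smul_mk, G_smul_mk]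

theorem incl_injective : Function.Injective (incl k M) := fun _ _ h =>
  congrArg (fun m : Envelope M => m.2.2.2) h

/-- The endomorphism of the envelope that maps its socle to its top. -/
noncomputable def socleToTop : Envelope M →ₗ[k] Envelope M where
  toFun m := mk (gen k .g • gen k .G • m.2.2.2) 0 0 0
  map_add' m n := by
    rw [mk_add_mk, ← smul_add, ← smul_add, add_zero]; rfl
  map_smul' c m := by
    change mk (gen k .g • gen k .G • c • m.2.2.2) 0 0 0 =
      mk (c • gen k .g • gen k .G • m.2.2.2) (c • 0) (c • 0) (c • 0)
    rw [smul_comm _ c, smul_comm _ c, smul_zero]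

variable {M} in
theorem socleToTop_mk (a b c d : M) :
    socleToTop k M (mk a b c d) = mk (gen k .g • gen k .G • d) 0 0 0 := rfl

/-- In moving the first coordinate to the last, `x` introduces a twist by `g` and `X` a twist by
`G`; the factor `gG` in `socleToTop` cancels both. -/
theorem hasUnitTrace : HasUnitTrace k (Envelope M) := by
  refine ⟨socleToTop k M, ?_, ?_, ?_⟩ <;> rintro ⟨a, b, c, d⟩
  · change socleToTop k M (gen k .g • mk a b c d) = _ • socleToTop k M (mk a b c d)
    simp [g_smul_mk, socleToTop_mk, G_g_smul]
  · change socleToTop k M (gen k .G • mk a b c d) = _ • socleToTop k M (mk a b c d)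
    simp [G_smul_mk, socleToTop_mk, G_g_smul]
  · change preTrace (socleToTop k M) (mk a b c d) = mk a b c d
    simp only [preTrace_apply, socleToTop_mk, x_smul_mk, X_smul_mk, smul_add, smul_sub, g_g_smul,
      G_G_smul, G_g_smul, X_x_smul, x_g_smul, x_G_smul, X_g_smul, X_G_smul,
      smul_neg, smul_zero, mk_add_mk, mk_sub_mk, neg_neg]
    congr 1 <;> abel

end Envelope

end Envelope

end DTaft

/-! ### Dade's lemma: from homotopies to a unit trace -/

theorem LinearMap.exists_mul_mul_eq {k V : Type*} [Field k] [AddCommGroup V] [Module k V]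
    (p : V →ₗ[k] V) : ∃ t : V →ₗ[k] V, ∀ v, p (t (p v)) = p v := by
  obtain ⟨s, hs⟩ := p.rangeRestrict.exists_rightInverse_of_surjective p.range_rangeRestrict
  obtain ⟨t, ht⟩ := s.exists_extend
  refine ⟨t, fun v => ?_⟩
  have h1 : t (p v) = s (p.rangeRestrict v) := LinearMap.congr_fun ht (p.rangeRestrict v)
  rw [h1]
  exact congrArg Subtype.val (LinearMap.congr_fun hs (p.rangeRestrict v))

/-- The map induced by `T` on the nonzero space `K / (K ∩ W)` has an eigenvalue, as `k` is
algebraically closed. -/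
theorem LinearMap.exists_eigenvector_modulo {k V : Type*} [Field k] [IsAlgClosed k]
    [AddCommGroup V] [Module k V] [FiniteDimensional k V] (T : V →ₗ[k] V) {K W : Submodule k V}
    (hK : ∀ v ∈ K, T v ∈ K) (hW : ∀ v ∈ K, v ∈ W → T v ∈ W) (hKW : ¬ K ≤ W) :
    ∃ (c : k) (v : V), v ∈ K ∧ v ∉ W ∧ T v - c • v ∈ W := by
  let W' := W.comap K.subtype
  let S : K →ₗ[k] K := T.restrict hK
  have hS : W' ≤ W'.comap S := fun v hv => hW v v.2 hv
  have : Nontrivial (K ⧸ W') := by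
    rw [Submodule.Quotient.nontrivial_iff]
    intro h
    exact hKW fun v hv => (h ▸ Submodule.mem_top : (⟨v, hv⟩ : K) ∈ W')
  obtain ⟨c, hc⟩ := Module.End.exists_eigenvalue (W'.mapQ W' S hS)
  obtain ⟨v, hv⟩ := hc.exists_hasEigenvector
  obtain ⟨v, rfl⟩ := Submodule.Quotient.mk_surjective _ v
  refine ⟨c, v, v.2, fun h => hv.2 ((Submodule.Quotient.mk_eq_zero W').mpr h), ?_⟩
  have h := hv.apply_eq_smul
  rw [Submodule.mapQ_apply, ← Submodule.Quotient.mk_smul, Submodule.Quotient.eq] at h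
  exact h

namespace DTaft

variable {k : Type u} [Field k] {M N : Type*}
  [AddCommGroup M] [Module k M] [Module (D k) M] [IsScalarTower k (D k) M]
  [AddCommGroup N] [Module k N] [Module (D k) N] [IsScalarTower k (D k) N]

variable (k M) in
/-- The action of the central idempotent `(1 + gG) / 2`. -/
noncomputable def evenProj : M →ₗ[D k] M :=
  LinearMap.ofAdjoin (k := k) (adjoin_range_gen k)
    ((2⁻¹ : k) • (LinearMap.id + Algebra.lsmul k k M (gen k .g) ∘ₗ
      Algebra.lsmul k k M (gen k .G))) <| by
  have hc : ∀ (a : D k) (c : k) (n : M), a • c • n = c • a • n := fun a c n => smul_comm a c n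
  rintro _ ⟨_ | _, rfl⟩ m <;>
  simp only [LinearMap.smul_apply, LinearMap.add_apply, LinearMap.id_apply, LinearMap.comp_apply,
    Algebra.lsmul_coe, hc, smul_add, x_g_smul, X_g_smul, x_G_smul, X_G_smul, G_g_smul, smul_neg,
    neg_neg, g_g_smul]

theorem evenProj_apply (m : M) :
    evenProj k M m = (2⁻¹ : k) • (m + gen k .g • gen k .G • m) := rfl

theorem g_G_smul_evenProj (m : M) :
    gen k .g • gen k .G • evenProj k M m = evenProj k M m := by
  have hc : ∀ (a : D k) (c : k) (n : M), a • c • n = c • a • n := fun a c n => smul_comm a c n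
  simp only [evenProj_apply, hc, smul_add, G_g_smul, g_g_smul, G_G_smul, add_comm]

omit [Module k M] [IsScalarTower k (D k) M] in
theorem X_x_smul_of_even {m : M} (hm : gen k .g • gen k .G • m = m) :
    gen k .X • gen k .x • m = -(gen k .x • gen k .X • m) := by
  rw [X_x_smul, hm, sub_self, zero_sub]

omit [Module k M] [IsScalarTower k (D k) M] in
theorem g_G_x_smul (m : M) : gen k .g • gen k .G • gen k .x • m =
    gen k .x • gen k .g • gen k .G • m := by
  simp only [x_g_smul, x_G_smul, smul_neg, neg_neg]

theorem preTrace_comp (t : M →ₗ[k] M) (i : N →ₗ[D k] M) (p : M →ₗ[D k] N) (n : N) :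
    preTrace (p.restrictScalars k ∘ₗ t ∘ₗ i.restrictScalars k) n = p (preTrace t (i n)) := by
  simp only [preTrace_apply, map_add, map_sub, map_smul i, map_smul p,
      LinearMap.comp_apply, LinearMap.restrictScalars_apply]

section Dade

variable (h2 : (2 : k) ≠ 0)
include h2

theorem evenProj_of_even {m : M} (hm : gen k .g • gen k .G • m = m) : evenProj k M m = m := by
  rw [evenProj_apply, hm, inv_two_smul_add_self h2]

variable [IsAlgClosed k] [FiniteDimensional k M]
  (H : ∀ α β : k, (α, β) ≠ (0, 0) → ∃ h : M →ₗ[k] M, ∀ m,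
    (α • gen k .x + β • gen k .X) • h m + h ((α • gen k .x + β • gen k .X) • m) = m)
include H

/-- Division of `Xv` by `x` defines an operator `T` on the kernel `K` of `xX` in the part `gG = 1`,
and `T` descends modulo `W = xM + XM`. An eigenvector with eigenvalue `c` outside `W` can be
corrected to an element killed by `X - cx`; the homotopy for `X - cx` puts that element in `W`. -/
theorem exists_eq_add_of_x_X_smul_eq_zero {m : M} (hm : gen k .g • gen k .G • m = m)
    (hxX : gen k .x • gen k .X • m = 0) :
    ∃ a b : M, gen k .g • gen k .G • a = a ∧ gen k .g • gen k .G • b = b ∧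
      m = gen k .x • a + gen k .X • b := by
  obtain ⟨h, hh⟩ := H 1 0 (by simp)
  simp only [one_smul, zero_smul, add_zero] at hh
  let lx := Algebra.lsmul k k M (gen k .x)
  let lX := Algebra.lsmul k k M (gen k .X)
  let lc := Algebra.lsmul k k M (gen k .g) ∘ₗ Algebra.lsmul k k M (gen k .G)
  let W : Submodule k M := LinearMap.range lx ⊔ LinearMap.range lX
  let K : Submodule k M := LinearMap.ker (lx ∘ₗ lX) ⊓ LinearMap.ker (lc - LinearMap.id)
  have memK : ∀ v, v ∈ K ↔ gen k .x • gen k .X • v = 0 ∧ gen k .g • gen k .G • v = v :=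
    fun v => and_congr Iff.rfl sub_eq_zero
  have memW : ∀ a b : M, gen k .x • a + gen k .X • b ∈ W := fun a b =>
    Submodule.add_mem_sup ⟨a, rfl⟩ ⟨b, rfl⟩
  have W_even : ∀ v ∈ W, gen k .g • gen k .G • v = v → ∃ a b : M, gen k .g • gen k .G • a = a ∧
      gen k .g • gen k .G • b = b ∧ v = gen k .x • a + gen k .X • b := by
    intro v hv hc
    obtain ⟨_, ⟨a, rfl⟩, _, ⟨b, rfl⟩, rfl⟩ := Submodule.mem_sup.mp hv
    refine ⟨evenProj k M a, evenProj k M b, g_G_smul_evenProj a, g_G_smul_evenProj b, ?_⟩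
    rw [← map_smul, ← map_smul, ← map_add]
    exact (evenProj_of_even h2 hc).symm
  -- For `v` in `K`, `x` kills `Xv`, so `Xv = x h(Xv)`; projecting to the part `gG = 1` keeps `x T v
  -- = X v`.
  let T : M →ₗ[k] M := (evenProj k M).restrictScalars k ∘ₗ h ∘ₗ lX
  have T_apply : ∀ v, T v = evenProj k M (h (gen k .X • v)) := fun _ => rfl
  have x_T : ∀ v ∈ K, gen k .x • T v = gen k .X • v := by
    intro v hv
    rw [memK] at hv
    have e := hh (gen k .X • v)
    rw [hv.1, map_zero, add_zero] at e
    rw [T_apply, ← map_smul, e, map_smul, evenProj_of_even h2 hv.2]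
  have T_even : ∀ v, gen k .g • gen k .G • T v = T v := fun v => g_G_smul_evenProj _
  suffices hKW : K ≤ W from W_even m (hKW ((memK m).mpr ⟨hxX, hm⟩)) hm
  have T_K : ∀ v ∈ K, T v ∈ K := by
    intro v hv
    refine (memK _).mpr ⟨?_, T_even v⟩
    rw [← neg_eq_zero, ← X_x_smul_of_even (T_even v), x_T v hv, X_X_smul]
  -- For `v = xa + Xb`, `T` kills `Xb`, while `T(xa) + Xa` is killed by `x` and so lies in `xM`.
  have T_W : ∀ v ∈ K, v ∈ W → T v ∈ W := by
    intro v hv hvW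
    obtain ⟨a, b, ha, hb, rfl⟩ := W_even v hvW ((memK v).mp hv).2
    have hxa : gen k .x • a ∈ K := by
      refine (memK _).mpr ⟨?_, by rw [g_G_x_smul, ha]⟩
      rw [X_x_smul_of_even ha, smul_neg, x_x_smul, neg_zero]
    have e := hh (T (gen k .x • a) + gen k .X • a)
    have e0 : gen k .x • (T (gen k .x • a) + gen k .X • a) = 0 := by
      rw [smul_add, x_T _ hxa, X_x_smul_of_even ha, neg_add_cancel]
    rw [e0, map_zero, add_zero] at e
    have e1 : T (gen k .X • b) = 0 := by rw [T_apply, X_X_smul, map_zero, map_zero]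
    have e2 : T (gen k .x • a) = gen k .x • h (T (gen k .x • a) + gen k .X • a)
        + gen k .X • (-a) := by
      nth_rw 1 [e]
      rw [smul_neg]; abel
    rw [map_add, e1, add_zero, e2]
    exact memW _ _
  by_contra hKW
  obtain ⟨c, v, hvK, hvW, hv⟩ := T.exists_eigenvector_modulo (K := K) (W := W) T_K T_W hKW
  apply hvW
  have hv' := (memK v).mp hvK
  obtain ⟨a, b, ha, hb, hab⟩ := W_even _ hv (by
    simp only [smul_sub, smul_comm _ c, T_even, hv'.2])
  have hxv : gen k .X • v - c • gen k .x • v = gen k .x • gen k .X • b := by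
    have e := congrArg (gen k .x • ·) hab
    simpa only [smul_sub, smul_add, x_x_smul, zero_add, x_T v hvK,
      smul_comm (gen k .x) c v] using e
  -- The correction `xb` is chosen so that `(X - cx)(v + xb) = xXb + Xxb = 0`.
  obtain ⟨h', hh'⟩ := H (-c) 1 (by simp)
  have e := hh' (v + gen k .x • b)
  have e0 : ((-c) • gen k .x + (1 : k) • gen k .X) • (v + gen k .x • b) = 0 := by
    rw [add_smul, smul_assoc, smul_assoc, one_smul, smul_add, x_x_smul, add_zero, smul_add,
      X_x_smul_of_even hb, ← hxv, neg_smul]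
    abel
  rw [e0, map_zero, add_zero, add_smul, smul_assoc, smul_assoc, one_smul,
    ← smul_comm (gen k .x)] at e
  have e1 : v = (gen k .x • ((-c) • h' (v + gen k .x • b)) + gen k .X • h' (v + gen k .x • b))
      - (gen k .x • b + gen k .X • (0 : M)) := by
    rw [e, smul_zero]; abel
  rw [e1]
  exact W.sub_mem (memW _ _) (memW _ _)

/-- It suffices to find an even `t` whose trace `σ` is invertible: `σ` is `D(Λ₂)`-linear, so `tσ⁻¹`
has trace one. -/
theorem hasUnitTrace_of_homotopies : HasUnitTrace k M := by
  let p : M →ₗ[k] M := Algebra.lsmul k k M (gen k .x) ∘ₗ Algebra.lsmul k k M (gen k .X) ∘ₗ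
    (evenProj k M).restrictScalars k
  have p_apply : ∀ m, p m = gen k .x • gen k .X • evenProj k M m := fun _ => rfl
  obtain ⟨t₀, ht₀⟩ := p.exists_mul_mul_eq
  have p_g : ∀ m, p (gen k .g • m) = gen k .g • p m := fun m => by
    simp only [p_apply, map_smul, x_g_smul, X_g_smul, smul_neg, neg_neg]
  have p_G : ∀ m, p (gen k .G • m) = gen k .G • p m := fun m => by
    simp only [p_apply, map_smul, x_G_smul, X_G_smul, smul_neg, neg_neg]
  have average : ∀ (a : D k) (t : M →ₗ[k] M), a * a = 1 → (∀ m, p (a • m) = a • p m) →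
      (∀ m, p (t (p m)) = p m) → ∀ m, p (twistedAverage (1 : k) a t (p m)) = p m := by
    intro a t ha hpa ht m
    rw [twistedAverage_apply, map_smul, map_add, ← hpa, one_smul, hpa, ht, ht, hpa, smul_smul, ha,
      one_smul, inv_two_smul_add_self h2]
  let t₁ := twistedAverage₂ (1 : k) (gen k .g) (gen k .G) t₀
  have ht₁ : ∀ m, p (t₁ (p m)) = p m := average _ _ (gen_g_mul_self k) p_g
    (average _ _ (gen_G_mul_self k) p_G ht₀)
  have t₁_g : ∀ m, t₁ (gen k .g • m) = gen k .g • t₁ m := fun m =>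
    (twistedAverage₂_smul_left (by norm_num) _ (gen_g_mul_self k) t₀ m).trans (one_smul _ _)
  have t₁_G : ∀ m, t₁ (gen k .G • m) = gen k .G • t₁ m := fun m =>
    (twistedAverage₂_smul_right (by norm_num) (gen_G_mul_self k) (gen_g_mul_G k) t₀ m).trans
      (one_smul _ _)
  -- The second summand has trace `1 - e`, with `e` the idempotent `(1 + gG)/2`; the first affects
  -- only the part `gG = 1`.
  let t : M →ₗ[k] M := (evenProj k M).restrictScalars k ∘ₗ t₁ ∘ₗ (evenProj k M).restrictScalars k
    + (4⁻¹ : k) • (Algebra.lsmul k k M (gen k .x) ∘ₗ Algebra.lsmul k k M (gen k .X))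
  have t_apply : ∀ m, t m = evenProj k M (t₁ (evenProj k M m))
    + (4⁻¹ : k) • gen k .x • gen k .X • m := fun _ => rfl
  have t_g : ∀ m, t (gen k .g • m) = gen k .g • t m := fun m => by
    simp only [t_apply, map_smul, t₁_g, smul_add, x_g_smul, X_g_smul, smul_neg, neg_neg,
      smul_comm (gen k .g) (4⁻¹ : k)]
  have t_G : ∀ m, t (gen k .G • m) = gen k .G • t m := fun m => by
    simp only [t_apply, map_smul, t₁_G, smul_add, x_G_smul, X_G_smul, smul_neg, neg_neg,
      smul_comm (gen k .G) (4⁻¹ : k)]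
  let σ := trace t t_g t_G
  have σ_apply : ∀ m, σ m = evenProj k M (preTrace t₁ (evenProj k M m))
      + (m - evenProj k M m) := by
    intro m
    have e1 : preTrace ((4⁻¹ : k) • (Algebra.lsmul k k M (gen k .x) ∘ₗ
        Algebra.lsmul k k M (gen k .X))) m = m - evenProj k M m := by
      have h4 : (4⁻¹ : k) = 2⁻¹ * 2⁻¹ := by rw [← mul_inv]; norm_num
      have hc : ∀ (a : D k) (n : M), a • (4⁻¹ : k) • n = (4⁻¹ : k) • a • n :=
        fun a n => smul_comm a _ n
      simp only [preTrace_apply, LinearMap.smul_apply, LinearMap.comp_apply, Algebra.lsmul_coe, hc]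
      simp only [evenProj_apply, X_x_smul, x_x_smul, X_X_smul, smul_sub, x_g_smul, X_g_smul,
        x_G_smul, X_G_smul, smul_neg, neg_neg, smul_zero, G_g_smul, g_g_smul, G_G_smul, h4]
      have e : ∀ (a : D k) (n : M), a • n = Algebra.lsmul k k M a n := fun _ _ => rfl
      simp only [e]
      match_scalars <;> field_simp <;> ring
    rw [← preTrace_comp, ← e1]
    simp only [σ, trace_apply, preTrace_apply, t, LinearMap.add_apply, smul_add]
    abel
  have σ_even : ∀ m, gen k .g • gen k .G • m = m →
      σ m = evenProj k M (preTrace t₁ m) := fun m hm => by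
    rw [σ_apply, evenProj_of_even h2 hm, sub_self, add_zero]
  -- After applying `xX`, only the last term of the trace survives. It equals `xX t₁(xXm)`, which is
  -- `xXm` by the choice of `t₁`.
  have p_σ : ∀ m, gen k .g • gen k .G • m = m →
      gen k .x • gen k .X • σ m = gen k .x • gen k .X • m := by
    intro m hm
    have hp : p m = gen k .x • gen k .X • m := by rw [p_apply, evenProj_of_even h2 hm]
    have e1 : t₁ (gen k .X • gen k .x • m) = -t₁ (p m) := by
      rw [X_x_smul_of_even hm, map_neg, hp]
    have hX : ∀ n, gen k .x • gen k .X • gen k .x • evenProj k M n = 0 := fun n => by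
      rw [X_x_smul_of_even (g_G_smul_evenProj n), smul_neg, x_x_smul, neg_zero]
    have hXX : ∀ n, gen k .x • gen k .X • gen k .x • gen k .X • evenProj k M n = 0 := fun n => by
      rw [← map_smul, hX]
    rw [σ_even m hm, preTrace_apply, e1]
    simp only [map_add, map_sub, map_neg, map_smul, smul_add, smul_sub, smul_neg, hX, hXX,
      X_X_smul, smul_zero]
    rw [← p_apply (t₁ (p m)), ht₁, hp]
    abel
  have σ_inj : Function.Injective σ := by
    rw [injective_iff_map_eq_zero]
    intro m hm
    have hme : gen k .g • gen k .G • m = m := by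
      have e := congrArg (fun n => n - evenProj k M n) (σ_apply m)
      have hq : ∀ n, evenProj k M (evenProj k M n) = evenProj k M n := fun n =>
        evenProj_of_even h2 (g_G_smul_evenProj n)
      simp only [hm, map_zero, map_add, map_sub, hq, sub_self, add_zero, add_sub_cancel_left] at e
      rw [sub_eq_zero.mp e.symm, g_G_smul_evenProj]
    obtain ⟨a, b, ha, hb, rfl⟩ := exists_eq_add_of_x_X_smul_eq_zero h2 H hme
      (by rw [← p_σ m hme, hm, smul_zero, smul_zero])
    rw [map_add, map_smul, map_smul] at hm
    have hσa : gen k .g • gen k .G • σ a = σ a := by rw [← map_smul, ← map_smul, ha]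
    have hb' : gen k .x • gen k .X • b = 0 := by
      rw [← p_σ b hb]
      simpa only [smul_add, x_x_smul, zero_add, smul_zero] using congrArg (gen k .x • ·) hm
    have ha' : gen k .x • gen k .X • a = 0 := by
      rw [← p_σ a ha, ← neg_eq_zero, ← X_x_smul_of_even hσa]
      simpa only [smul_add, X_X_smul, add_zero, smul_zero] using congrArg (gen k .X • ·) hm
    -- Applying the division lemma again writes the kernel element as `xX(a₂ - b₁)`. By `p_σ` and
    -- linearity `σ` fixes it, so it is zero.
    obtain ⟨a₁, a₂, ha₁, ha₂, rfl⟩ := exists_eq_add_of_x_X_smul_eq_zero h2 H ha ha'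
    obtain ⟨b₁, b₂, hb₁, hb₂, rfl⟩ := exists_eq_add_of_x_X_smul_eq_zero h2 H hb hb'
    have e : gen k .x • (gen k .x • a₁ + gen k .X • a₂) + gen k .X • (gen k .x • b₁ + gen k .X • b₂)
        = gen k .x • gen k .X • (a₂ - b₁) := by
      simp only [smul_add, smul_sub, x_x_smul, X_X_smul, X_x_smul_of_even hb₁]
      abel
    rw [← map_smul, ← map_smul, ← map_add, e, map_smul, map_smul, p_σ _ (by
      rw [smul_sub, smul_sub, ha₂, hb₁])] at hm
    rw [e, hm]
  have σ_bij : Function.Bijective σ := ⟨σ_inj,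
    (LinearMap.injective_iff_surjective (f := σ.restrictScalars k)).mp σ_inj⟩
  let e := LinearEquiv.ofBijective σ σ_bij
  refine ⟨t ∘ₗ (e.symm : M →ₗ[D k] M).restrictScalars k, fun m => ?_, fun m => ?_, fun m => ?_⟩
  · simp [t_g]
  · simp [t_G]
  · have h := preTrace_comp t (e.symm : M →ₗ[D k] M) LinearMap.id m
    exact h.trans (e.apply_symm_apply m)

end Dade

end DTaft

/-! ### Projectivity in split exact sequences -/

section SplitExact

variable {R M₁ M₂ M₃ : Type*} [Semiring R]
  [AddCommGroup M₁] [Module R M₁] [AddCommGroup M₂] [Module R M₂] [AddCommGroup M₃] [Module R M₃]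
  {f : M₁ →ₗ[R] M₂} {h : M₂ →ₗ[R] M₃}

theorem Function.Exact.projective_left (hfh : Function.Exact f h) (hf : Function.Injective f)
    (hh : Function.Surjective h) [Module.Projective R M₂] [Module.Projective R M₃] :
    Module.Projective R M₁ := by
  obtain ⟨r, hr⟩ := ((hfh.split_tfae hf hh).out 0 1).mp
    (Module.projective_lifting_property h LinearMap.id hh)
  exact Module.Projective.of_split f r hr

theorem Function.Exact.projective_middle (hfh : Function.Exact f h) (hf : Function.Injective f)
    (hh : Function.Surjective h) [Module.Projective R M₁] [Module.Projective R M₃] :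
    Module.Projective R M₂ := by
  obtain ⟨e, -⟩ := ((hfh.split_tfae hf hh).out 0 2).mp
    (Module.projective_lifting_property h LinearMap.id hh)
  exact Module.Projective.of_equiv e.symm

end SplitExact

/-! ### Fitting decomposition, projective covers and injective hulls -/

theorem Module.Injective.of_retract {R : Type*} [Ring R] {M N : Type u} [AddCommGroup M]
    [Module R M] [AddCommGroup N] [Module R N] (hM : Module.Injective R M) (i : N →ₗ[R] M)
    (r : M →ₗ[R] N) (hri : ∀ n, r (i n) = n) : Module.Injective R N where
  out X Y _ _ _ _ f hf w := by
    obtain ⟨v, hv⟩ := hM.out f hf (i ∘ₗ w)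
    exact ⟨r ∘ₗ v, fun x => by simp [hv, hri]⟩

/-- Fitting's lemma: for large `n`, the kernel of `φ ^ n` is a complement of its range. Taking `n ≥
1` ensures that the kernel of `φ` lies in that of `φ ^ n`. -/
theorem LinearMap.exists_retraction_range_pow {R M : Type*} [Ring R] [AddCommGroup M] [Module R M]
    [IsNoetherian R M] [IsArtinian R M] (φ : M →ₗ[R] M) :
    ∃ n, 1 ≤ n ∧ (LinearMap.range (φ ^ n) = ⊤ → LinearMap.ker φ = ⊥) ∧
      ∃ r : M →ₗ[R] LinearMap.range (φ ^ n), ∀ v, r (v : LinearMap.range (φ ^ n)) = v := by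
  obtain ⟨n, hn, hn1⟩ :=
    (φ.eventually_isCompl_ker_pow_range_pow.and (Filter.eventually_ge_atTop 1)).exists
  refine ⟨n, hn1, fun h => ?_, Submodule.projectionOnto _ _ hn.symm,
    fun v => Submodule.projectionOnto_apply_left hn.symm v⟩
  have h' := hn.inf_eq_bot
  rw [h, inf_top_eq] at h'
  rw [eq_bot_iff, ← h']
  obtain ⟨m, rfl⟩ := Nat.exists_eq_add_of_le' hn1
  intro v hv
  rw [LinearMap.mem_ker, pow_succ, Module.End.mul_apply, LinearMap.mem_ker.mp hv, map_zero]

namespace FDMod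

variable {k A : Type u} [Field k] [Ring A] [Algebra k A]

/-- A submodule as a finite-dimensional module. -/
def ofSubmodule (M : FDMod k A) (U : Submodule A M) : FDMod k A where
  carrier := U
  finiteDimensional := FiniteDimensional.of_injective (U.subtype.restrictScalars k)
    U.injective_subtype

/-- A quotient as a finite-dimensional module. -/
def quotient (M : FDMod k A) (U : Submodule A M) : FDMod k A where
  carrier := M ⧸ U
  finiteDimensional := Module.Finite.of_surjective (U.mkQ.restrictScalars k) U.mkQ_surjective

instance (M : FDMod k A) : IsNoetherian A M := isNoetherian_of_tower k inferInstance

instance (M : FDMod k A) : IsArtinian A M := isArtinian_of_tower k inferInstance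

theorem eq_top_of_finrank_le (M : FDMod k A) (U : Submodule A M)
    (h : Module.finrank k M ≤ Module.finrank k (M.ofSubmodule U)) : U = ⊤ := by
  have h' : U.restrictScalars k = ⊤ :=
    Submodule.eq_top_of_finrank_eq (le_antisymm (Submodule.finrank_le _) h)
  exact (Submodule.restrictScalars_eq_top_iff k A M).mp h'

/-- A projective `P` of least dimension over `M` works. If `U` also surjects onto `M`, lifting `π`
through `U` gives an endomorphism `φ` over `M` with range in `U`; the range of `φ ^ n` is a summand
still covering `M`, so it is all of `P`. -/
theorem exists_isProjectiveCover (M : FDMod k A)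
    (hM : ∃ (P : FDMod k A) (π : P →ₗ[A] M), Module.Projective A P ∧ Function.Surjective π) :
    ∃ (P : FDMod k A) (π : P →ₗ[A] M), IsProjectiveCover π := by
  classical
  have hex : ∃ n, ∃ (P : FDMod k A) (π : P →ₗ[A] M), Module.Projective A P ∧
      Function.Surjective π ∧ Module.finrank k P = n := by
    obtain ⟨P, π, hP, hπ⟩ := hM
    exact ⟨_, P, π, hP, hπ, rfl⟩
  obtain ⟨P, π, hP, hπ, hn⟩ := Nat.find_spec hex
  refine ⟨P, π, hP, hπ, fun U hU => ?_⟩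
  have hπU : Function.Surjective (π ∘ₗ U.subtype) := by
    intro m
    obtain ⟨p, rfl⟩ := hπ m
    obtain ⟨v, hv, w, hw, rfl⟩ := Submodule.mem_sup.mp (hU ▸ Submodule.mem_top : p ∈ U ⊔ _)
    exact ⟨⟨v, hv⟩, by simp [LinearMap.mem_ker.mp hw]⟩
  obtain ⟨ψ, hψ⟩ := Module.projective_lifting_property _ π hπU
  let φ : P →ₗ[A] P := U.subtype ∘ₗ ψ
  have hφ : ∀ p, π (φ p) = π p := LinearMap.congr_fun hψ
  obtain ⟨n, hn1, -, r, hr⟩ := φ.exists_retraction_range_pow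
  have hφn : ∀ n p, π ((φ ^ n) p) = π p := by
    intro n
    induction n with
    | zero => exact fun p => rfl
    | succ n ih => exact fun p => by rw [pow_succ, Module.End.mul_apply, ih, hφ]
  have htop : LinearMap.range (φ ^ n) = ⊤ := by
    refine P.eq_top_of_finrank_le _ ?_
    rw [hn]
    refine Nat.find_min' hex ⟨P.ofSubmodule _, π ∘ₗ (LinearMap.range (φ ^ n)).subtype, ?_, ?_, rfl⟩
    · exact Module.Projective.of_split (LinearMap.range (φ ^ n)).subtype r (LinearMap.ext hr)
    · intro m
      obtain ⟨p, rfl⟩ := hπ m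
      exact ⟨⟨_, p, rfl⟩, hφn n p⟩
  rw [eq_top_iff, ← htop]
  rintro _ ⟨p, rfl⟩
  obtain ⟨m, rfl⟩ := Nat.exists_eq_add_of_le' hn1
  rw [pow_succ', Module.End.mul_apply]
  exact (ψ _).2

/-- Dually, if `U` meets `M` trivially, extending `ι` along `M → I/U` gives an endomorphism of `I`
that fixes `M` and kills `U`; least dimension forces it to be injective. -/
theorem exists_isInjectiveHull (M : FDMod k A)
    (hM : ∃ (I : FDMod k A) (ι : M →ₗ[A] I), Module.Injective A I ∧ Function.Injective ι) :
    ∃ (I : FDMod k A) (ι : M →ₗ[A] I), IsInjectiveHull ι := by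
  classical
  have hex : ∃ n, ∃ (I : FDMod k A) (ι : M →ₗ[A] I), Module.Injective A I ∧
      Function.Injective ι ∧ Module.finrank k I = n := by
    obtain ⟨I, ι, hI, hι⟩ := hM
    exact ⟨_, I, ι, hI, hι, rfl⟩
  obtain ⟨I, ι, hI, hι, hn⟩ := Nat.find_spec hex
  refine ⟨I, ι, hI, hι, fun U hU => ?_⟩
  have hιU : Function.Injective (U.mkQ ∘ₗ ι) := by
    rw [injective_iff_map_eq_zero]
    intro m hm
    have hm' : ι m ∈ U ⊓ LinearMap.range ι :=
      ⟨(Submodule.Quotient.mk_eq_zero U).mp hm, m, rfl⟩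
    rw [hU] at hm'
    exact hι (hm'.trans (map_zero ι).symm)
  obtain ⟨ψ, hψ⟩ := hI.out (U.mkQ ∘ₗ ι) hιU ι
  let φ : I →ₗ[A] I := ψ ∘ₗ U.mkQ
  obtain ⟨n, hn1, hker, r, hr⟩ := φ.exists_retraction_range_pow
  have hφn : ∀ n m, (φ ^ n) (ι m) = ι m := by
    intro n
    induction n with
    | zero => exact fun m => rfl
    | succ n ih =>
      intro m
      rw [pow_succ, Module.End.mul_apply]
      exact (congrArg (φ ^ n) (hψ m)).trans (ih m)
  have htop : LinearMap.range (φ ^ n) = ⊤ := by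
    refine I.eq_top_of_finrank_le _ ?_
    rw [hn]
    refine Nat.find_min' hex ⟨I.ofSubmodule _,
      ι.codRestrict (LinearMap.range (φ ^ n)) fun m => ⟨ι m, hφn n m⟩, ?_, ?_, rfl⟩
    · exact hI.of_retract (LinearMap.range (φ ^ n)).subtype r hr
    · exact fun a b hab => hι (congrArg Subtype.val hab)
  rw [eq_bot_iff, ← hker htop]
  intro v hv
  have hv' : U.mkQ v = 0 := (Submodule.Quotient.mk_eq_zero U).mpr hv
  rw [LinearMap.mem_ker, LinearMap.comp_apply, hv', map_zero]

end FDMod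

/-! ### The rank variety and its conditions -/

namespace DTaft

variable {k : Type u} [Field k]

variable (k) in
-- The projection from the envelope splits over `H_{αβ}`, so the homotopy that the envelope's unit
-- trace supplies can be compressed to `M`.
theorem exists_homotopy_of_projective (M : Type u) [AddCommGroup M] [Module k M] [Module (D k) M]
    [IsScalarTower k (D k) M] {α β : k} (hαβ : (α, β) ≠ (0, 0))
    [Module.Projective (H k α β) M] :
    ∃ h : M →ₗ[k] M, ∀ m, H.y k α β • h m + h (H.y k α β • m) = m := by
  obtain ⟨h, hh⟩ := (Envelope.hasUnitTrace k M).exists_homotopy hαβ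
  let π : Envelope M →ₗ[H k α β] M := (Envelope.proj k M).restrictScalars (H k α β)
  obtain ⟨s, hs⟩ := Module.projective_lifting_property π LinearMap.id
    (Envelope.proj_surjective k M)
  refine ⟨π.restrictScalars k ∘ₗ h ∘ₗ s.restrictScalars k, fun m => ?_⟩
  have e := congrArg π (hh (s m))
  have hs' : π (s m) = m := LinearMap.congr_fun hs m
  rw [hs', map_add] at e
  refine Eq.trans ?_ e
  simp only [LinearMap.comp_apply, LinearMap.restrictScalars_apply]
  rw [← map_smul π, map_smul s]
  rfl

end DTaft

namespace DTaft

variable {k : Type u} [Field k]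

theorem mem_rankVariety_iff {M : FDMod k (D k)} {p : k × k} (hp : p ≠ (0, 0)) :
    p ∈ rankVariety k M ↔ ¬ Module.Projective (H k p.1 p.2) M :=
  or_iff_right hp

theorem zero_mem_rankVariety (M : FDMod k (D k)) : (0 : k × k) ∈ rankVariety k M := Or.inl rfl

theorem rankVariety_congr {M N : FDMod k (D k)} (e : M ≃ₗ[D k] N) :
    rankVariety k M = rankVariety k N := by
  ext p
  refine or_congr Iff.rfl (not_congr ⟨fun _ => ?_, fun _ => ?_⟩)
  · exact Module.Projective.of_equiv (e.restrictScalars (H k p.1 p.2))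
  · exact Module.Projective.of_equiv (e.restrictScalars (H k p.1 p.2)).symm

theorem hasUnitTrace_of_projective (M : FDMod k (D k)) [Module.Projective (D k) M] :
    HasUnitTrace k M := by
  obtain ⟨s, hs⟩ := Module.projective_lifting_property (Envelope.proj k M) LinearMap.id
    (Envelope.proj_surjective k M)
  exact (Envelope.hasUnitTrace k M).of_retract s (Envelope.proj k M)
    (LinearMap.congr_fun hs)

theorem hasUnitTrace_of_injective (M : FDMod k (D k)) (hM : Module.Injective (D k) M) :
    HasUnitTrace k M := by
  obtain ⟨r, hr⟩ := hM.out (Envelope.incl k M) (Envelope.incl_injective k M) LinearMap.id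
  exact (Envelope.hasUnitTrace k M).of_retract (Envelope.incl k M) r hr

variable (k) in
/-- The envelope as a finite-dimensional module. -/
noncomputable def envelope (M : FDMod k (D k)) : FDMod k (D k) where
  carrier := Envelope M

section

variable (h2 : (2 : k) ≠ 0)
include h2

theorem projective_of_homotopy {M : FDMod k (D k)} {α β : k}
    (h : ∃ h : M →ₗ[k] M, ∀ m, H.y k α β • h m + h (H.y k α β • m) = m) :
    Module.Projective (H k α β) M := by
  obtain ⟨h, hh⟩ := h
  exact (H.isSignedPresentation k α β).projective_of_homotopy h2 hh

theorem projective_restrict {M : FDMod k (D k)} (hM : HasUnitTrace k M) {α β : k}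
    (hαβ : (α, β) ≠ (0, 0)) : Module.Projective (H k α β) M :=
  projective_of_homotopy h2 (hM.exists_homotopy hαβ)

theorem rankVariety_eq_of_hasUnitTrace {M : FDMod k (D k)} (hM : HasUnitTrace k M) :
    rankVariety k M = {0} := by
  refine Set.Subset.antisymm (fun p hp => ?_) (Set.singleton_subset_iff.mpr (zero_mem_rankVariety M))
  by_contra h0
  exact (mem_rankVariety_iff h0).mp hp (projective_restrict h2 hM h0)

theorem projective_iff_forall_restrict [IsAlgClosed k] (M : FDMod k (D k)) :
    Module.Projective (D k) M ↔
      ∀ α β : k, (α, β) ≠ (0, 0) → Module.Projective (H k α β) M := by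
  refine ⟨fun _ α β h => projective_restrict h2 (hasUnitTrace_of_projective M) h, fun h => ?_⟩
  refine (hasUnitTrace_of_homotopies h2 fun α β hαβ => ?_).projective h2
  have := h α β hαβ
  exact exists_homotopy_of_projective k M hαβ

variable (k) in
theorem rankVariety_condC2 : CondC2 (rankVariety k) := by
  intro M₁ M₂ M₃ f h hf hfh hh
  have key : ∀ A B C : FDMod k (D k), (∀ p : k × k, p ≠ (0, 0) →
      Module.Projective (H k p.1 p.2) B → Module.Projective (H k p.1 p.2) C →
      Module.Projective (H k p.1 p.2) A) →
      rankVariety k A ⊆ rankVariety k B ∪ rankVariety k C := by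
    intro A B C hABC p hp
    by_cases h0 : p = (0, 0)
    · exact Or.inl (h0 ▸ zero_mem_rankVariety B)
    · by_contra hBC
      rw [Set.mem_union, not_or, mem_rankVariety_iff h0, mem_rankVariety_iff h0, not_not,
        not_not] at hBC
      exact (mem_rankVariety_iff h0).mp hp (hABC p h0 hBC.1 hBC.2)
  have restrict : ∀ p : k × k, ∃ (f' : M₁ →ₗ[H k p.1 p.2] M₂) (h' : M₂ →ₗ[H k p.1 p.2] M₃),
      Function.Exact f' h' ∧ Function.Injective f' ∧ Function.Surjective h' := fun p =>
    ⟨f.restrictScalars _, h.restrictScalars _, hfh, hf, hh⟩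
  refine ⟨key _ _ _ fun p hp _ _ => ?_, key _ _ _ fun p hp _ _ => ?_,
    key _ _ _ fun p hp _ _ => ?_⟩ <;> obtain ⟨f', h', hfh', hf', hh'⟩ := restrict p
  · exact hfh'.projective_left hf' hh'
  · exact hfh'.projective_middle hf' hh'
  -- Here `M₁` and `M₂` are projective. The homotopy on `M₁` makes the inclusion split, so `M₃` is a
  -- summand of `M₂`.
  · obtain ⟨h₁, hh₁⟩ := exists_homotopy_of_projective k M₁ hp
    obtain ⟨r, hr⟩ := (H.isSignedPresentation k p.1 p.2).exists_retraction h2 hh₁ f' hf'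
    have hr' : ∃ r : M₂ →ₗ[H k p.1 p.2] M₁, r ∘ₗ f' = LinearMap.id := ⟨r, LinearMap.ext hr⟩
    obtain ⟨s, hs⟩ := ((hfh'.split_tfae hf' hh').out 0 1).mpr hr'
    exact Module.Projective.of_split s h' hs

variable (k) in
theorem rankVariety_condC1 : CondC1 (rankVariety k) := by
  intro M N
  refine Set.Subset.antisymm ?_ (Set.union_subset ?_ ?_)
  · exact (rankVariety_condC2 k h2 M (M.directSum N) N (LinearMap.inl (D k) M N)
      (LinearMap.snd (D k) M N) LinearMap.inl_injective Function.Exact.inl_snd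
      LinearMap.snd_surjective).2.1
  · rintro p (hp | hp)
    · exact Or.inl hp
    · refine Or.inr fun _ => hp ?_
      let i : M →ₗ[D k] M.directSum N := LinearMap.inl (D k) M N
      let r : M.directSum N →ₗ[D k] M := LinearMap.fst (D k) M N
      exact Module.Projective.of_split (i.restrictScalars (H k p.1 p.2))
        (r.restrictScalars (H k p.1 p.2)) rfl
  · rintro p (hp | hp)
    · exact Or.inl hp
    · refine Or.inr fun _ => hp ?_
      let i : N →ₗ[D k] M.directSum N := LinearMap.inr (D k) M N
      let r : M.directSum N →ₗ[D k] N := LinearMap.snd (D k) M N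
      exact Module.Projective.of_split (i.restrictScalars (H k p.1 p.2))
        (r.restrictScalars (H k p.1 p.2)) rfl

variable (k) in
theorem exists_isOmega (M : FDMod k (D k)) : ∃ N : FDMod k (D k), FDMod.IsOmega M N := by
  have hP : Module.Projective (D k) (Envelope M) := (Envelope.hasUnitTrace k M).projective h2
  obtain ⟨P, π, hπ⟩ := M.exists_isProjectiveCover
    ⟨envelope k M, Envelope.proj k M, hP, Envelope.proj_surjective k M⟩
  exact ⟨P.ofSubmodule (LinearMap.ker π), P, (LinearMap.ker π).subtype, π, hπ,
    Submodule.injective_subtype _, LinearMap.exact_subtype_ker_map π⟩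

variable (k) in
theorem exists_isOmegaInv (M : FDMod k (D k)) : ∃ N : FDMod k (D k), FDMod.IsOmegaInv M N := by
  have hI : Module.Injective (D k) (Envelope M) := (Envelope.hasUnitTrace k M).injective h2
  obtain ⟨I, ι, hι⟩ := M.exists_isInjectiveHull
    ⟨envelope k M, Envelope.incl k M, hI, Envelope.incl_injective k M⟩
  exact ⟨I.quotient (LinearMap.range ι), I, ι, (LinearMap.range ι).mkQ, hι,
    Submodule.mkQ_surjective _, LinearMap.exact_map_mkQ_range ι⟩

/-- The middle term is projective, so its variety is `{0}`, and (C2) gives both inclusions;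
minimality of the cover plays no role. -/
theorem rankVariety_of_isOmega {M N : FDMod k (D k)} (h : FDMod.IsOmega M N) :
    rankVariety k N = rankVariety k M := by
  obtain ⟨P, i, π, ⟨hP, hπ, -⟩, hi, hiπ⟩ := h
  obtain ⟨h₁, -, h₃⟩ := rankVariety_condC2 k h2 N P M i π hi hiπ hπ
  have hP' := rankVariety_eq_of_hasUnitTrace h2 (hasUnitTrace_of_projective P)
  rw [hP'] at h₁ h₃
  rw [Set.union_eq_right.mpr (Set.singleton_subset_iff.mpr (zero_mem_rankVariety M))] at h₁
  rw [Set.union_eq_left.mpr (Set.singleton_subset_iff.mpr (zero_mem_rankVariety N))] at h₃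
  exact Set.Subset.antisymm h₁ h₃

theorem rankVariety_of_isOmegaInv {M N : FDMod k (D k)} (h : FDMod.IsOmegaInv M N) :
    rankVariety k N = rankVariety k M := by
  obtain ⟨I, i, π, ⟨hI, hi, -⟩, hπ, hiπ⟩ := h
  obtain ⟨h₁, -, h₃⟩ := rankVariety_condC2 k h2 M I N i π hi hiπ hπ
  have hI' := rankVariety_eq_of_hasUnitTrace h2 (hasUnitTrace_of_injective I hI)
  rw [hI'] at h₁ h₃
  rw [Set.union_eq_right.mpr (Set.singleton_subset_iff.mpr (zero_mem_rankVariety N))] at h₁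
  rw [Set.union_eq_left.mpr (Set.singleton_subset_iff.mpr (zero_mem_rankVariety M))] at h₃
  exact Set.Subset.antisymm h₃ h₁

variable (k) in
theorem rankVariety_condC3 : CondC3 (rankVariety k) := by
  have iterate : ∀ R : FDMod k (D k) → FDMod k (D k) → Prop, (∀ M, ∃ N, R M N) →
      (∀ M N, R M N → rankVariety k N = rankVariety k M) → ∀ (n : ℕ) (M : FDMod k (D k)),
      (∃ N, FDMod.IterateRel R n M N) ∧
        ∀ N, FDMod.IterateRel R n M N → rankVariety k N = rankVariety k M := by
    intro R hex hV n M
    induction n with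
    | zero => exact ⟨⟨M, ⟨LinearEquiv.refl _ _⟩⟩, fun N ⟨e⟩ => (rankVariety_congr e).symm⟩
    | succ n ih =>
      obtain ⟨⟨L, hL⟩, ih⟩ := ih
      obtain ⟨N, hN⟩ := hex L
      exact ⟨⟨N, L, hL, hN⟩, fun N' ⟨L', hL', hN'⟩ => (hV L' N' hN').trans (ih L' hL')⟩
  rintro (n | n) M
  · exact iterate _ (exists_isOmega k h2) (fun _ _ => rankVariety_of_isOmega h2) n M
  · exact iterate _ (exists_isOmegaInv k h2) (fun _ _ => rankVariety_of_isOmegaInv h2) (n + 1) M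

variable (k) in
theorem rankVariety_condC4 [IsAlgClosed k] : CondC4 (rankVariety k) := by
  intro M
  refine ⟨fun h => (projective_iff_forall_restrict h2 M).mpr fun α β hαβ => ?_,
    fun _ => rankVariety_eq_of_hasUnitTrace h2 (hasUnitTrace_of_projective M)⟩
  by_contra hM
  have hmem : (α, β) ∈ rankVariety k M := Or.inr hM
  rw [h] at hmem
  exact hαβ hmem

end

end DTaft

theorem mainTheorem4 (k : Type u) [Field k] [IsAlgClosed k] (hk : ringChar k ≠ 2) :
    DetectsProjectivity {B : Subalgebra k (DTaft.D k) |
        ∃ α β : k, (α, β) ≠ (0, 0) ∧ B = DTaft.H k α β} ∧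
      CondC1 (DTaft.rankVariety k) ∧ CondC2 (DTaft.rankVariety k) ∧
      CondC3 (DTaft.rankVariety k) ∧ CondC4 (DTaft.rankVariety k) := by
  have h2 : (2 : k) ≠ 0 := Ring.two_ne_zero hk
  refine ⟨fun M => (DTaft.projective_iff_forall_restrict h2 M).trans ⟨?_, fun h α β hαβ => ?_⟩,
    DTaft.rankVariety_condC1 k h2, DTaft.rankVariety_condC2 k h2, DTaft.rankVariety_condC3 k h2,
    DTaft.rankVariety_condC4 k h2⟩
  · rintro h _ ⟨α, β, hαβ, rfl⟩
    exact h α β hαβ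
  · exact h _ ⟨α, β, hαβ, rfl⟩
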